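/- Let $\kappa, c>0$ and put $\beta_n=\frac{\kappa^2}{c^2}(n+1)$ for $n\ge 0$ and $\gamma=\kappa/c$, so that $\gamma^2=\beta_0$. With $\psi(n)=\sum_{m=1}^n\frac1m$ ($\psi(0)=0$) and Euler's constant $C$, let, for $z>0$, $$I_0(z)=\sum_{n\ge0}\frac{1}{(n!)^2}\Big(\frac z2\Big)^{2n},\qquad I_1(z)=\sum_{n\ge0}\frac{1}{n!(n+1)!}\Big(\frac z2\Big)^{2n+1},$$ $$K_0(z)=-\Big(\ln\frac z2+C\Big)I_0(z)+\sum_{n\ge1}\frac{\psi(n)}{(n!)^2}\Big(\frac z2\Big)^{2n},$$ $$K_1(z)=\frac1z+\Big(\ln\frac z2+C\Big)I_1(z)-\frac12\sum_{n\ge0}\frac{\psi(n+1)+\psi(n)}{n!(n+1)!}\Big(\frac z2\Big)^{2n+1}$$ be the modified Bessel and Hankel functions. Define $a_{n,0}=1$, $a_{n,n}=-\frac{1}{2\gamma n}\beta_1a_{n-1,n-1}$ for $n\ge1$, and $$a_{n,k}=\frac{1}{2\gamma k}\Big\{4\Big[\frac{k+1}{2}\Big]^2a_{n,k+1}-\sum_{m=k-1}^{n-1}\beta_{n-m}a_{m,k-1}\Big\},\qquad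 k=n-1,\dots,1,$$ and the polynomials $v_n(r)=\sum_{k=0}^{[n/2]}a_{n,2k}r^{2k}$, $w_0=0$, $w_n(r)=\sum_{k=0}^{[(n-1)/2]}a_{n,2k+1}r^{2k+1}$ for $n\ge1$. For $x\ne y$ in $\mathbb{R}^2$ set $$\Phi_n(x,y)=K_0(\gamma|x-y|)\,v_n(|x-y|)+K_1(\gamma|x-y|)\,w_n(|x-y|).$$ Let $\Omega\subset\mathbb{R}^2$ be a bounded domain whose boundary $\Gamma$ is of class $C^3$, that is, a finite disjoint union of simple closed curves with regular $2\pi$-periodic $C^3$ parametrizations. Let $\nu$ be the outward unit normal, $ds$ arc length, and $d/ds$ the derivative along $\Gamma$ with respect to arc length, where $\Gamma$ is oriented so that $\Omega$ lies to its left. Let $0<\alpha\le1$ and let $q_0,q_1,\dots$ be real functions on $\Gamma$ of class $C^{1,\alpha}$. For $n\ge0$ and $f\in C^{1,\alpha}(\Gamma)$ define $$(\mathcal D_nf)(z)=\frac1\pi\int_\Gamma f(y)\,\frac{\partial\Phi_n(z,y)}{\partial\nu(y)}\,ds(y),\qquad z\notin\Gamma,$$ and, for $x\in\Gamma$, $$(\mathcal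 H_nf)(x)=\frac1\pi\frac{d}{ds(x)}\int_\Gamma\frac{df}{ds}(y)\,\Phi_n(x,y)\,ds(y),\qquad (\mathcal L_nf)(x)=\frac1\pi\,\nu(x)\cdot\int_\Gamma f(y)\,\nu(y)\sum_{k=0}^n\beta_{n-k}\Phi_k(x,y)\,ds(y).$$ Then for all $n\ge0$ and $x\in\Gamma$ the integrals and the derivative in $(\mathcal H_{n-m}q_m)(x)$ and $(\mathcal L_{n-m}q_m)(x)$, $0\le m\le n$, exist, and the normal derivative of $\sum_{m=0}^n\mathcal D_{n-m}q_m$ at $x$ exists from both sides of $\Gamma$ and satisfies $$\frac{\partial}{\partial\nu(x)}\sum_{m=0}^n(\mathcal D_{n-m}q_m)(x)=\sum_{m=0}^n\big[(\mathcal H_{n-m}q_m)(x)-(\mathcal L_{n-m}q_m)(x)\big].$$ Here the normal derivative at $x$ of a function $u$ that is differentiable at $x+h\nu(x)$ for all small $h\ne0$ is the limit of $\nu(x)\cdot\nabla u(x+h\nu(x))$ as $h\to0$, $h\neq 0$; the limits for $h\to0^-$ (from $\Omega$) and for $h\to0^+$ (from outside) coincide. -/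

import Mathlib

open Real Set Filter Topology MeasureTheory
open scoped NNReal Nat

namespace LaguerreBIE

noncomputable section

/-- The Euclidean plane. -/
abbrev Plane : Type := EuclideanSpace ℝ (Fin 2)

/-! ### The fundamental sequence -/

/-- `β_n = (κ² / c²) (n + 1)`. -/
def beta (κ c : ℝ) (n : ℕ) : ℝ := κ ^ 2 / c ^ 2 * (n + 1)

/-- For `κ, c > 0` this is the positive number `γ` with `γ² = β_0`. -/
def gamma (κ c : ℝ) : ℝ := κ / c

theorem gamma_sq (κ c : ℝ) : gamma κ c ^ 2 = beta κ c 0 := by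
  simp [gamma, beta, div_pow]

/-- Modified Bessel function `I_0`. -/
def besselI0 (z : ℝ) : ℝ := ∑' n : ℕ, 1 / ((n ! : ℝ) ^ 2) * (z / 2) ^ (2 * n)

/-- Modified Bessel function `I_1`. -/
def besselI1 (z : ℝ) : ℝ :=
  ∑' n : ℕ, 1 / ((n ! : ℝ) * ((n + 1)! : ℝ)) * (z / 2) ^ (2 * n + 1)

/-- Modified Hankel (Macdonald) function `K_0`. Here `harmonic n = ∑_{m=1}^n 1/m`; the term of
index `0` of the series vanishes since `harmonic 0 = 0`. -/
def besselK0 (z : ℝ) : ℝ :=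
  -(log (z / 2) + eulerMascheroniConstant) * besselI0 z
    + ∑' n : ℕ, (harmonic n : ℝ) / ((n ! : ℝ) ^ 2) * (z / 2) ^ (2 * n)

/-- Modified Hankel (Macdonald) function `K_1`. -/
def besselK1 (z : ℝ) : ℝ :=
  1 / z + (log (z / 2) + eulerMascheroniConstant) * besselI1 z
    - 1 / 2 * ∑' n : ℕ, ((harmonic (n + 1) : ℝ) + (harmonic n : ℝ))
        / ((n ! : ℝ) * ((n + 1)! : ℝ)) * (z / 2) ^ (2 * n + 1)

/-- The coefficients `a_{n,k}`, with `a_{n,k} = 0` for `k > n`. -/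
def coeff (κ c : ℝ) : ℕ → ℕ → ℝ
  | _, 0 => 1
  | n, k + 1 =>
    if k + 1 < n then
      1 / (2 * gamma κ c * ((k + 1 : ℕ) : ℝ)) *
        (4 * (((k + 2) / 2 : ℕ) : ℝ) ^ 2 * coeff κ c n (k + 2)
          - ∑ m ∈ (Finset.Ico k n).attach, beta κ c (n - m.1) * coeff κ c m.1 k)
    else if h : k + 1 = n then
      -(1 / (2 * gamma κ c * (n : ℝ))) * beta κ c 1 * coeff κ c (n - 1) k
    else 0
  termination_by n k => (n, n + 1 - k)
  decreasing_by
    · exact Prod.Lex.right _ (by omega)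
    · exact Prod.Lex.left _ _ (Finset.mem_Ico.1 m.2).2
    · exact Prod.Lex.left _ _ (by omega)

theorem coeff_zero (κ c : ℝ) (n : ℕ) : coeff κ c n 0 = 1 := by
  rw [coeff]

theorem coeff_self (κ c : ℝ) (n : ℕ) (hn : 1 ≤ n) :
    coeff κ c n n = -(1 / (2 * gamma κ c * n)) * beta κ c 1 * coeff κ c (n - 1) (n - 1) := by
  obtain ⟨k, rfl⟩ : ∃ k, n = k + 1 := ⟨n - 1, by omega⟩
  rw [coeff]
  simp

theorem coeff_rec (κ c : ℝ) (n k : ℕ) (hk : 1 ≤ k) (hkn : k < n) :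
    coeff κ c n k = 1 / (2 * gamma κ c * k) *
      (4 * (((k + 1) / 2 : ℕ) : ℝ) ^ 2 * coeff κ c n (k + 1)
        - ∑ m ∈ Finset.Icc (k - 1) (n - 1), beta κ c (n - m) * coeff κ c m (k - 1)) := by
  obtain ⟨k, rfl⟩ : ∃ l, k = l + 1 := ⟨k - 1, by omega⟩
  have h : Finset.Icc (k + 1 - 1) (n - 1) = Finset.Ico k n := by
    ext m
    simp only [Finset.mem_Icc, Finset.mem_Ico]
    omega
  rw [coeff, if_pos hkn, h, ← Finset.sum_attach (Finset.Ico k n)]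
  rfl

/-- The polynomials `v_n`. -/
def polyV (κ c : ℝ) (n : ℕ) (r : ℝ) : ℝ :=
  ∑ k ∈ Finset.range (n / 2 + 1), coeff κ c n (2 * k) * r ^ (2 * k)

/-- The polynomials `w_n`, with `w_0 = 0`. -/
def polyW (κ c : ℝ) (n : ℕ) (r : ℝ) : ℝ :=
  if n = 0 then 0
  else ∑ k ∈ Finset.range ((n - 1) / 2 + 1), coeff κ c n (2 * k + 1) * r ^ (2 * k + 1)

/-- The fundamental sequence `Φ_n(x, y)`, a function of `|x - y|`. -/
def Phi (κ c : ℝ) (n : ℕ) (x y : Plane) : ℝ :=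
  besselK0 (gamma κ c * ‖x - y‖) * polyV κ c n ‖x - y‖
    + besselK1 (gamma κ c * ‖x - y‖) * polyW κ c n ‖x - y‖

/-! ### Domains with `C³` boundary -/

/-- For a regular plane curve `x`, the unit normal `(x₂', -x₁') / |x'|` at the parameter `s`, which
lies to the right of the direction in which the curve is traversed. -/
def unitNormal (x : ℝ → Plane) (s : ℝ) : Plane :=
  ‖deriv x s‖⁻¹ • !₂[deriv x s 1, -(deriv x s 0)]

/-- A bounded domain in the plane with boundary of class `C³`. The boundary consists of finitely
many disjoint simple closed curves; each of them comes with a regular `2π`-periodic `C³`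
parametrization, oriented so that the domain lies to its left. -/
structure C3Domain where
  /-- the domain -/
  carrier : Set Plane
  isOpen : IsOpen carrier
  isConnected : IsConnected carrier
  isBounded : Bornology.IsBounded carrier
  /-- the number of components of the boundary -/
  numCurves : ℕ
  /-- the parametrizations of the components of the boundary -/
  curve : Fin numCurves → ℝ → Plane
  contDiff : ∀ j, ContDiff ℝ 3 (curve j)
  periodic : ∀ j, Function.Periodic (curve j) (2 * π)
  regular : ∀ j s, deriv (curve j) s ≠ 0
  simple : ∀ i j s t, curve i s = curve j t → i = j ∧ ∃ k : ℤ, t = s + k * (2 * π)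
  frontier_eq : frontier carrier = ⋃ j, range (curve j)
  outward : ∀ j s, ∀ᶠ h : ℝ in 𝓝[>] 0,
    curve j s - h • unitNormal (curve j) s ∈ carrier ∧
      curve j s + h • unitNormal (curve j) s ∉ closure carrier

namespace C3Domain

variable (Ω : C3Domain)

/-- The outward unit normal `ν` at the boundary point `curve j s`. -/
def normal (j : Fin Ω.numCurves) (s : ℝ) : Plane := unitNormal (Ω.curve j) s

/-- The derivative `dg/ds` with respect to arc length along the `j`-th boundary curve, for a
function `g` of the parameter. -/
def arcDeriv (j : Fin Ω.numCurves) (g : ℝ → ℝ) (s : ℝ) : ℝ :=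
  ‖deriv (Ω.curve j) s‖⁻¹ * deriv g s

/-- Integrability with respect to arc length on the boundary, for a function `F` of the boundary
point `curve j σ`. -/
def BoundaryIntegrable {V : Type*} [NormedAddCommGroup V] [NormedSpace ℝ V]
    (F : Fin Ω.numCurves → ℝ → V) : Prop :=
  ∀ j, IntervalIntegrable (fun σ => ‖deriv (Ω.curve j) σ‖ • F j σ) volume 0 (2 * π)

/-- The integral with respect to arc length over the boundary. -/
def boundaryIntegral {V : Type*} [NormedAddCommGroup V] [NormedSpace ℝ V]
    (F : Fin Ω.numCurves → ℝ → V) : V :=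
  ∑ j, ∫ σ in (0 : ℝ)..(2 * π), ‖deriv (Ω.curve j) σ‖ • F j σ

/-- The restriction of `f` to the boundary is of Hölder class `C^{1,α}`. Only the values of `f` on
the boundary matter. -/
def IsC1Holder (α : ℝ≥0) (f : Plane → ℝ) : Prop :=
  ∀ j, ContDiff ℝ 1 (fun s => f (Ω.curve j s)) ∧
    ∃ C : ℝ≥0, HolderWith C α (deriv fun s => f (Ω.curve j s))

/-- The double-layer potential
`(D_n f)(z) = (1/π) ∫_Γ f(y) ∂Φ_n(z, y)/∂ν(y) ds(y)`, for `z` off the boundary `Γ`. -/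
def doubleLayer (κ c : ℝ) (n : ℕ) (f : Plane → ℝ) (z : Plane) : ℝ :=
  1 / π * Ω.boundaryIntegral fun j σ =>
    f (Ω.curve j σ) * fderiv ℝ (fun y => Phi κ c n z y) (Ω.curve j σ) (Ω.normal j σ)

/-- The integrand `df/ds(y) Φ_n(x, y)`, as a function of the boundary point `y`. -/
def integrandH (κ c : ℝ) (n : ℕ) (f : Plane → ℝ) (x : Plane) (j : Fin Ω.numCurves) (σ : ℝ) : ℝ :=
  Ω.arcDeriv j (fun t => f (Ω.curve j t)) σ * Phi κ c n x (Ω.curve j σ)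

/-- The operator `(H_n f)(x) = (1/π) d/ds(x) ∫_Γ df/ds(y) Φ_n(x, y) ds(y)`, at `x = curve j s`. -/
def opH (κ c : ℝ) (n : ℕ) (f : Plane → ℝ) (j : Fin Ω.numCurves) (s : ℝ) : ℝ :=
  1 / π * Ω.arcDeriv j (fun t => Ω.boundaryIntegral (Ω.integrandH κ c n f (Ω.curve j t))) s

/-- The integrand `f(y) (∑_{k ≤ n} β_{n-k} Φ_k(x, y)) ν(y)`, as a function of the boundary
point `y`. -/
def integrandL (κ c : ℝ) (n : ℕ) (f : Plane → ℝ) (x : Plane) (j : Fin Ω.numCurves) (σ : ℝ) :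
    Plane :=
  (f (Ω.curve j σ) *
    ∑ k ∈ Finset.range (n + 1), beta κ c (n - k) * Phi κ c k x (Ω.curve j σ)) • Ω.normal j σ

/-- The operator `(L_n f)(x) = (1/π) ν(x) · ∫_Γ f(y) ν(y) ∑_{k ≤ n} β_{n-k} Φ_k(x, y) ds(y)`, at
`x = curve j s`. -/
def opL (κ c : ℝ) (n : ℕ) (f : Plane → ℝ) (j : Fin Ω.numCurves) (s : ℝ) : ℝ :=
  1 / π * inner ℝ (Ω.normal j s) (Ω.boundaryIntegral (Ω.integrandL κ c n f (Ω.curve j s)))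

end C3Domain

/-- The function `u`, given off a curve, has the normal derivative `l` at the point `x` of the curve
with unit normal `ν`, from both sides of the curve: `ν · grad u(x + h ν) → l` as `h → 0`, both for
`h < 0` and for `h > 0`. -/
def HasNormalDeriv (u : Plane → ℝ) (x ν : Plane) (l : ℝ) : Prop :=
  (∀ᶠ h : ℝ in 𝓝[≠] 0, DifferentiableAt ℝ u (x + h • ν)) ∧
    Tendsto (fun h : ℝ => fderiv ℝ u (x + h • ν) ν) (𝓝[≠] 0) (𝓝 l)

end

end LaguerreBIE

/-!
# Normal derivative of double-layer potentials with the kernels `Φ_n`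

It is enough to treat one double layer `D_n f`. Two facts about the kernel carry the proof. As a
function of `ρ = |x - y|²`, `Φ_n` is `-(1/2) log ρ (1 + ρ A(ρ)) + B(ρ)` with smooth `A` and `B`
(`profile_eq`), so that `Φ_n(x, y) = -log |x - y|` up to a `C¹` function of `x - y`
(`contDiff_regularKernel`). Moreover `ΔΦ_n = ∑_{k ≤ n} β_{n-k} Φ_k` off the diagonal
(`profile_ode`); given `K_0' = -K_1` and `(z K_1)' = -z K_0` this is the recurrence for the
coefficients `a_{n,k}`.

Off the boundary the double layer may be differentiated under the integral, which produces the
Hessian `H` of the kernel between the normals at `y` and at `x`. A normal is a tangent turned by a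
right angle `J`, and `Jᵀ H J = tr(H) - H` in the plane (`radialHess_rotR_rotR`). The trace is the
Laplacian and gives a single layer with kernel `∑ β_{n-k} Φ_k`; the other term is a derivative along
the boundary, and after an integration by parts it is the tangential derivative of the single layer
with density `df/ds` (`doubleLayer_curve_fderiv_rotR`).

It remains to let the point tend to the boundary along the normal. The first layer is continuous
there and gives `-L_n f`. For the second one the tangential derivatives have to converge, to the
derivative of the boundary values. This is `HasTangentialTrace.tendsto_fderiv`: it suffices that
the derivatives in the direction `γ'(t)` at the points `γ(t) + h ν`, `h ≠ 0`, extend continuously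
to `h = 0` as a function of `(t, h)`, since the derivatives then converge locally uniformly in `t`.
For the logarithmic kernel and a Hölder continuous density `ψ` one subtracts the total derivative of
the logarithm along the curve, whose integral is zero (`logLayer_fderiv_apply_eq`). The integrand
becomes `⟨d, ψ(t + u) γ'(t) - ψ(t) γ'(t + u)⟩ / |d|²` with `d = γ(t) + h ν - γ(t + u)`, and as
`|d| ≥ c |u|` uniformly in `h` (`eventually_mul_abs_le_norm_chord`), it is dominated by a multiple
of `|u|^(α - 1)`.
-/

namespace LaguerreBIE

/-! ### Integrals depending on a point of the plane -/

theorem continuousOn_intervalIntegral_param {X E : Type*} [TopologicalSpace X]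
    [FirstCountableTopology X] [NormedAddCommGroup E] [NormedSpace ℝ E]
    {U : Set X} {k : X → ℝ → E}
    (hk : ContinuousOn (Function.uncurry k) (U ×ˢ univ)) (a b : ℝ) :
    ContinuousOn (fun x => ∫ σ in a..b, k x σ) U := by
  rw [continuousOn_iff_continuous_domRestrict]
  refine intervalIntegral.continuous_parametric_intervalIntegral_of_continuous'
    (f := fun (x : U) σ => k x σ) ?_ a b
  exact hk.comp_continuous (f := fun p : U × ℝ => ((p.1 : X), p.2)) (by fun_prop)
    fun p => ⟨p.1.2, mem_univ _⟩

theorem hasFDerivAt_intervalIntegral_param {H : Type*} [NormedAddCommGroup H] [NormedSpace ℝ H]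
    [ProperSpace H] {U : Set H} (hU : IsOpen U) {k : H → ℝ → ℝ} {k' : H → ℝ → H →L[ℝ] ℝ}
    (hk : ContinuousOn (Function.uncurry k) (U ×ˢ univ))
    (hk' : ContinuousOn (Function.uncurry k') (U ×ˢ univ))
    (hd : ∀ z ∈ U, ∀ σ, HasFDerivAt (fun z => k z σ) (k' z σ) z) (a b : ℝ) {z : H} (hz : z ∈ U) :
    HasFDerivAt (fun z => ∫ σ in a..b, k z σ) (∫ σ in a..b, k' z σ) z := by
  obtain ⟨K, hKz, hKU, hK⟩ := local_compact_nhds (hU.mem_nhds hz)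
  have hslice : ∀ z ∈ U, Continuous (k z) := fun z hz =>
    hk.comp_continuous (f := fun σ => (z, σ)) (by fun_prop) fun σ => ⟨hz, mem_univ _⟩
  have hslice' : Continuous (k' z) :=
    hk'.comp_continuous (f := fun σ => (z, σ)) (by fun_prop) fun σ => ⟨hz, mem_univ _⟩
  obtain ⟨C, hC⟩ := (hK.prod (isCompact_uIcc (a := a) (b := b))).exists_bound_of_continuousOn
    (hk'.mono (prod_mono hKU (subset_univ _)))
  refine intervalIntegral.hasFDerivAt_integral_of_dominated_of_fderiv_le (bound := fun _ => C)
    hKz ?_ ((hslice z hz).intervalIntegrable _ _) hslice'.aestronglyMeasurable ?_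
    intervalIntegrable_const ?_
  · filter_upwards [hU.mem_nhds hz] with z hz using (hslice z hz).aestronglyMeasurable
  · exact .of_forall fun t ht x hx => hC (x, t) ⟨hx, uIoc_subset_uIcc ht⟩
  · exact .of_forall fun t _ x hx => hd x (hKU hx) t

/-! ### Continuity of the tangential derivative across a curve -/

/-- The function `u`, given near the point `γ s` of a curve, is continuous along the translates
`γ + h ν` of the curve, `h` near `0`, and its derivative in the direction `γ'` extends continuously
from the translates with `h ≠ 0` to the curve itself. -/
def HasTangentialTrace (γ : ℝ → Plane) (s : ℝ) (ν : Plane) (u : Plane → ℝ) : Prop :=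
  ∃ Ψ : ℝ × ℝ → ℝ, ∀ᶠ p : ℝ × ℝ in 𝓝 (s, 0), ContinuousAt Ψ p ∧
    ContinuousAt (fun p : ℝ × ℝ => u (γ p.1 + p.2 • ν)) p ∧
    (p.2 ≠ 0 → ∃ u' : Plane →L[ℝ] ℝ, HasFDerivAt u u' (γ p.1 + p.2 • ν) ∧ u' (deriv γ p.1) = Ψ p)

namespace HasTangentialTrace

variable {γ : ℝ → Plane} {s : ℝ} {ν : Plane} {u v : Plane → ℝ}

theorem add (hu : HasTangentialTrace γ s ν u) (hv : HasTangentialTrace γ s ν v) :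
    HasTangentialTrace γ s ν (fun z => u z + v z) := by
  obtain ⟨Ψ, hΨ⟩ := hu
  obtain ⟨Θ, hΘ⟩ := hv
  refine ⟨fun p => Ψ p + Θ p, ?_⟩
  filter_upwards [hΨ, hΘ] with p h₁ h₂
  refine ⟨h₁.1.add h₂.1, h₁.2.1.add h₂.2.1, fun hp => ?_⟩
  obtain ⟨u', hu, hu'⟩ := h₁.2.2 hp
  obtain ⟨v', hv, hv'⟩ := h₂.2.2 hp
  exact ⟨u' + v', hu.add hv, by simp [hu', hv']⟩

theorem neg (hu : HasTangentialTrace γ s ν u) : HasTangentialTrace γ s ν (fun z => -u z) := by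
  obtain ⟨Ψ, hΨ⟩ := hu
  refine ⟨fun p => -Ψ p, ?_⟩
  filter_upwards [hΨ] with p h
  refine ⟨h.1.neg, h.2.1.neg, fun hp => ?_⟩
  obtain ⟨u', hu, hu'⟩ := h.2.2 hp
  exact ⟨-u', hu.neg, by simp [hu']⟩

theorem sum {ι : Type*} (S : Finset ι) {u : ι → Plane → ℝ}
    (h : ∀ i ∈ S, HasTangentialTrace γ s ν (u i)) :
    HasTangentialTrace γ s ν (fun z => ∑ i ∈ S, u i z) := by
  classical
  induction S using Finset.induction_on with
  | empty =>
    refine ⟨0, .of_forall fun p => ⟨continuousAt_const, ?_, fun _ => ⟨0, ?_, rfl⟩⟩⟩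
    · simpa using continuousAt_const
    · simpa using hasFDerivAt_const (0 : ℝ) _
  | insert i S hi ih =>
    simp only [Finset.sum_insert hi]
    exact (h i (Finset.mem_insert_self _ _)).add
      (ih fun k hk => h k (Finset.mem_insert_of_mem hk))

/-- Functions of class `C¹` near the point `γ s`. -/
theorem of_hasFDerivAt (hγ : ContDiff ℝ 1 γ) {U : Set Plane} (hU : IsOpen U) (hs : γ s ∈ U)
    {u' : Plane → Plane →L[ℝ] ℝ} (hu : ∀ z ∈ U, HasFDerivAt u (u' z) z)
    (hu' : ContinuousOn u' U) : HasTangentialTrace γ s ν u := by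
  have hc : Continuous fun p : ℝ × ℝ => γ p.1 + p.2 • ν := by
    have := hγ.continuous
    fun_prop
  have hc' : Continuous fun p : ℝ × ℝ => deriv γ p.1 := by
    have := hγ.continuous_deriv le_rfl
    fun_prop
  have hmem : ∀ᶠ p : ℝ × ℝ in 𝓝 (s, 0), γ p.1 + p.2 • ν ∈ U :=
    hc.continuousAt.eventually_mem (by simpa using hU.mem_nhds hs)
  refine ⟨fun p => u' (γ p.1 + p.2 • ν) (deriv γ p.1), ?_⟩
  filter_upwards [hmem] with p hp
  refine ⟨?_, ?_, fun _ => ⟨_, hu _ hp, rfl⟩⟩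
  · exact ContinuousAt.clm_apply (ContinuousAt.comp (f := fun p : ℝ × ℝ => γ p.1 + p.2 • ν)
      (hu'.continuousAt (hU.mem_nhds hp)) hc.continuousAt) hc'.continuousAt
  · exact ContinuousAt.comp (f := fun p : ℝ × ℝ => γ p.1 + p.2 • ν)
      (hu _ hp).continuousAt hc.continuousAt

/-- As the tangential derivatives on the translates of the curve converge locally uniformly, their
limit is the derivative along the curve. -/
theorem tendsto_fderiv (hγ : Differentiable ℝ γ) (hu : HasTangentialTrace γ s ν u) :
    DifferentiableAt ℝ (fun t => u (γ t)) s ∧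
      Tendsto (fun h : ℝ => fderiv ℝ u (γ s + h • ν) (deriv γ s)) (𝓝[≠] 0)
        (𝓝 (deriv (fun t => u (γ t)) s)) := by
  obtain ⟨Ψ, hΨ⟩ := hu
  obtain ⟨I, hI, J, hJ, hIJ⟩ := mem_nhds_prod_iff.1 hΨ
  obtain ⟨T, hTI, hT, hsT⟩ := mem_nhds_iff.1 hI
  have h0 : (0 : ℝ) ∈ J := mem_of_mem_nhds hJ
  have key : ∀ t ∈ T, ∀ h ∈ J, _ := fun t ht h hh => @hIJ (t, h) ⟨hTI ht, hh⟩
  have hderiv : HasDerivAt (fun t => u (γ t)) (Ψ (s, 0)) s := by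
    refine hasDerivAt_of_tendstoLocallyUniformlyOn (l := 𝓝[≠] (0 : ℝ))
      (f := fun h t => u (γ t + h • ν)) (f' := fun h t => Ψ (t, h)) (g' := fun t => Ψ (t, 0))
      hT ?_ ?_ ?_ hsT
    · rw [Metric.tendstoLocallyUniformlyOn_iff]
      intro ε hε t ht
      have hc : ContinuousAt Ψ (t, 0) := (key t ht 0 h0).1
      obtain ⟨A, hA, B, hB, hAB⟩ := mem_nhds_prod_iff.1 (Metric.continuousAt_iff'.1 hc (ε / 2)
        (half_pos hε))
      refine ⟨A, mem_nhdsWithin_of_mem_nhds hA, ?_⟩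
      filter_upwards [mem_nhdsWithin_of_mem_nhds hB] with h hh y hy
      have h₁ : dist (Ψ (y, 0)) (Ψ (t, 0)) < ε / 2 := @hAB (y, 0) ⟨hy, mem_of_mem_nhds hB⟩
      have h₂ : dist (Ψ (y, h)) (Ψ (t, 0)) < ε / 2 := @hAB (y, h) ⟨hy, hh⟩
      linarith [dist_triangle_right (Ψ (y, 0)) (Ψ (y, h)) (Ψ (t, 0))]
    · filter_upwards [mem_nhdsWithin_of_mem_nhds hJ, self_mem_nhdsWithin] with h hh hne t ht
      obtain ⟨u', hu, hu'⟩ := (key t ht h hh).2.2 hne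
      simp only [← hu']
      exact hu.comp_hasDerivAt t ((hγ t).hasDerivAt.add_const _)
    · intro t ht
      have := (key t ht 0 h0).2.1
      have hc : ContinuousAt (fun h : ℝ => u (γ t + h • ν)) 0 :=
        ContinuousAt.comp (f := fun h : ℝ => (t, h)) this (by fun_prop)
      simpa using hc.tendsto.mono_left nhdsWithin_le_nhds
  refine ⟨hderiv.differentiableAt, ?_⟩
  rw [hderiv.deriv]
  have hc : ContinuousAt (fun h : ℝ => Ψ (s, h)) 0 :=
    ContinuousAt.comp (f := fun h : ℝ => (s, h)) (key s hsT 0 h0).1 (by fun_prop)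
  refine (hc.tendsto.mono_left nhdsWithin_le_nhds).congr' ?_
  filter_upwards [mem_nhdsWithin_of_mem_nhds hJ, self_mem_nhdsWithin] with h hh hne
  obtain ⟨u', hu, hu'⟩ := (key s hsT h hh).2.2 hne
  rw [hu.fderiv, hu']

theorem tendsto (hu : HasTangentialTrace γ s ν u) :
    Tendsto (fun h : ℝ => u (γ s + h • ν)) (𝓝 0) (𝓝 (u (γ s))) := by
  obtain ⟨Ψ, hΨ⟩ := hu
  have hc : ContinuousAt (fun h : ℝ => u (γ s + h • ν)) 0 :=
    ContinuousAt.comp (f := fun h : ℝ => (s, h)) hΨ.self_of_nhds.2.1 (by fun_prop)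
  simpa using hc.tendsto

end HasTangentialTrace

/-! ### Chords of a simple closed curve -/

/-- Near a point `γ s` of a simple closed curve, the distance of a translate `γ t + h ν` from the
curve point `γ (t + u)` is bounded below by a multiple of the parameter difference, uniformly in
the offset `h`. For small `u` this holds as the chord has a component of size `|u|` along the
tangent at `s`, which the offset does not change; for the other `u` by compactness. -/
theorem eventually_mul_abs_le_norm_chord {γ : ℝ → Plane} (hγ : ContDiff ℝ 1 γ) {s : ℝ}
    (hreg : deriv γ s ≠ 0) (hinj : ∀ t, γ s = γ t → ∃ k : ℤ, t = s + k * (2 * π)) {ν : Plane}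
    (hν : inner ℝ (deriv γ s) ν = 0) :
    ∃ c > 0, ∀ᶠ p : ℝ × ℝ in 𝓝 (s, 0), ∀ u ∈ Icc (-π) π,
      c * |u| ≤ ‖γ p.1 + p.2 • ν - γ (p.1 + u)‖ := by
  set e := deriv γ s with he
  have he0 : 0 < ‖e‖ := norm_pos_iff.2 hreg
  have hstrict : HasStrictDerivAt γ e s :=
    hγ.contDiffAt.hasStrictDerivAt one_ne_zero
  have hlo := hstrict.hasStrictFDerivAt.isLittleO.def (half_pos he0)
  obtain ⟨δ, hδ, hδ'⟩ := Metric.eventually_nhds_iff.1 hlo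
  have hnear : ∀ t h u : ℝ, |t - s| < δ / 2 → |u| < δ / 2 →
      ‖e‖ / 2 * |u| ≤ ‖γ t + h • ν - γ (t + u)‖ := by
    intro t h u ht hu
    have h1 : dist (t, t + u) (s, s) < δ := by
      rw [Prod.dist_eq, max_lt_iff, Real.dist_eq, Real.dist_eq]
      refine ⟨by linarith, ?_⟩
      calc |t + u - s| = |(t - s) + u| := by ring_nf
        _ ≤ |t - s| + |u| := abs_add_le _ _
        _ < δ := by linarith
    have h2 := hδ' h1
    simp only [sub_add_cancel_left, ContinuousLinearMap.toSpanSingleton_apply, norm_neg,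
      Real.norm_eq_abs] at h2
    have h3 : inner ℝ e (γ t + h • ν - γ (t + u))
        = inner ℝ e (γ t - γ (t + u) - (-u) • e) - u * ‖e‖ ^ 2 := by
      simp only [inner_sub_right, inner_add_right, inner_smul_right, hν,
        real_inner_self_eq_norm_sq]
      ring
    have h4 := abs_real_inner_le_norm e (γ t - γ (t + u) - (-u) • e)
    have h5 := abs_real_inner_le_norm e (γ t + h • ν - γ (t + u))
    have h6 : |u| * ‖e‖ ^ 2 ≤ ‖e‖ * (‖e‖ / 2 * |u|) + ‖e‖ * ‖γ t + h • ν - γ (t + u)‖ := by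
      have : |u| * ‖e‖ ^ 2 = |u * ‖e‖ ^ 2| := by rw [abs_mul, abs_of_nonneg (sq_nonneg ‖e‖)]
      rw [this]
      calc |u * ‖e‖ ^ 2| = |inner ℝ e (γ t - γ (t + u) - (-u) • e)
            - inner ℝ e (γ t + h • ν - γ (t + u))| := by rw [h3]; ring_nf
        _ ≤ _ := (abs_sub _ _).trans (add_le_add (h4.trans (by gcongr)) h5)
    refine le_of_mul_le_mul_left ?_ he0
    linarith [h6]
  -- the parameter differences that are not small
  have hK : IsCompact (Icc (-π) π ∩ {u : ℝ | δ / 2 ≤ |u|}) :=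
    isCompact_Icc.inter_right (isClosed_le continuous_const continuous_abs)
  have hcont := hγ.continuous
  have hpos : ∀ u ∈ Icc (-π) π ∩ {u : ℝ | δ / 2 ≤ |u|}, 0 < ‖γ s - γ (s + u)‖ := by
    rintro u ⟨⟨hu1, hu2⟩, hu3⟩
    refine norm_pos_iff.2 (sub_ne_zero.2 fun heq => ?_)
    obtain ⟨k, hk⟩ := hinj _ heq
    have hk' : u = k * (2 * π) := by linarith
    have hπ := pi_pos
    have k1 : (k : ℝ) < 1 := by nlinarith
    have k2 : (-1 : ℝ) < k := by nlinarith
    have k3 : k = 0 := by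
      have : k < 1 := by exact_mod_cast k1
      have : -1 < k := by exact_mod_cast k2
      omega
    change δ / 2 ≤ |u| at hu3
    rw [hk', k3] at hu3
    simp at hu3
    linarith
  obtain ⟨η, hη, hηK⟩ := hK.exists_forall_le' (f := fun u => ‖γ s - γ (s + u)‖)
    (by fun_prop) hpos
  have hfar : ∀ᶠ p : ℝ × ℝ in 𝓝 (s, 0), ∀ u ∈ Icc (-π) π ∩ {u : ℝ | δ / 2 ≤ |u|},
      η / 2 < ‖γ p.1 + p.2 • ν - γ (p.1 + u)‖ := by
    refine hK.eventually_forall_of_forall_eventually fun u hu => ?_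
    have hc : Continuous fun q : (ℝ × ℝ) × ℝ => ‖γ q.1.1 + q.1.2 • ν - γ (q.1.1 + q.2)‖ := by
      fun_prop
    refine hc.continuousAt.eventually (lt_mem_nhds ?_)
    simpa using lt_of_lt_of_le (half_lt_self hη) (hηK u hu)
  have hclose : ∀ᶠ p : ℝ × ℝ in 𝓝 (s, 0), |p.1 - s| < δ / 2 := by
    have : ContinuousAt (fun p : ℝ × ℝ => |p.1 - s|) (s, 0) := by fun_prop
    exact this.eventually (gt_mem_nhds (by simpa using hδ))
  refine ⟨min (‖e‖ / 2) (η / (2 * π)), lt_min (half_pos he0) (by positivity), ?_⟩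
  filter_upwards [hfar, hclose] with p hp1 hp2 u hu
  rcases lt_or_ge |u| (δ / 2) with h | h
  · exact (mul_le_mul_of_nonneg_right (min_le_left _ _) (abs_nonneg _)).trans
      (hnear _ _ _ hp2 h)
  · refine (mul_le_mul_of_nonneg_right (min_le_right _ _) (abs_nonneg _)).trans ?_
    have : |u| ≤ π := abs_le.2 hu
    calc η / (2 * π) * |u| ≤ η / (2 * π) * π := by gcongr
      _ = η / 2 := by field_simp
      _ ≤ _ := (hp1 u ⟨hu, h⟩).le

/-- The translates `γ t + h ν` with `h ≠ 0` do not meet the curve. -/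
theorem add_smul_notMem_range {γ : ℝ → Plane} (hper : Function.Periodic γ (2 * π)) {ν : Plane}
    (hν0 : ν ≠ 0) {c : ℝ} (hc : 0 < c) {p : ℝ × ℝ}
    (hp : ∀ u ∈ Icc (-π) π, c * |u| ≤ ‖γ p.1 + p.2 • ν - γ (p.1 + u)‖) (hp0 : p.2 ≠ 0) :
    γ p.1 + p.2 • ν ∉ range γ := by
  rintro ⟨σ, hσ⟩
  obtain ⟨y, hy, hyσ⟩ := hper.exists_mem_Ico (by positivity) σ (p.1 - π)
  have h1 := hp (y - p.1) ⟨by linarith [hy.1], by linarith [hy.2]⟩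
  rw [add_sub_cancel, ← hyσ, hσ, sub_self, norm_zero] at h1
  have h2 : y - p.1 = 0 := by
    have := abs_nonneg (y - p.1)
    exact abs_eq_zero.1 (le_antisymm (by nlinarith) this)
  have h3 : y = p.1 := by linarith
  rw [hyσ, h3] at hσ
  exact smul_ne_zero hp0 hν0 (by simpa using hσ)

theorem intervalIntegral_periodic_shift {E : Type*} [NormedAddCommGroup E] [NormedSpace ℝ E]
    {g : ℝ → E} (hg : Function.Periodic g (2 * π)) (t : ℝ) :
    ∫ σ in (0 : ℝ)..(2 * π), g σ = ∫ u in (-π)..π, g (t + u) := by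
  rw [intervalIntegral.integral_comp_add_left, ← zero_add (2 * π),
    hg.intervalIntegral_add_eq 0 (t + -π)]
  congr 1
  ring

theorem intervalIntegrable_abs_rpow {r : ℝ} (hr : -1 < r) (a b : ℝ) :
    IntervalIntegrable (fun u : ℝ => |u| ^ r) volume a b := by
  have h0 : ∀ b : ℝ, 0 ≤ b → IntervalIntegrable (fun u : ℝ => |u| ^ r) volume 0 b := by
    intro b hb
    refine (intervalIntegral.intervalIntegrable_rpow' hr).congr fun u hu => ?_
    rw [uIoc_of_le hb] at hu
    simp only [abs_of_pos hu.1]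
  have h1 : ∀ b : ℝ, IntervalIntegrable (fun u : ℝ => |u| ^ r) volume 0 b := by
    intro b
    rcases le_total 0 b with hb | hb
    · exact h0 b hb
    · rw [IntervalIntegrable.iff_comp_neg (by finiteness)]
      simpa using h0 (-b) (by linarith)
  exact (h1 a).symm.trans (h1 b)

theorem exists_norm_le_of_periodic {E : Type*} [NormedAddCommGroup E] {g : ℝ → E}
    (hg : Continuous g) (hp : Function.Periodic g (2 * π)) : ∃ M > 0, ∀ t, ‖g t‖ ≤ M := by
  obtain ⟨M, hM, h⟩ := (hp.isBounded_of_continuous (by positivity) hg).exists_pos_norm_le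
  exact ⟨M, hM, fun t => h _ (mem_range_self t)⟩

theorem periodic_deriv {E : Type*} [NormedAddCommGroup E] [NormedSpace ℝ E] {g : ℝ → E}
    {c : ℝ} (hg : Function.Periodic g c) : Function.Periodic (deriv g) c := by
  intro x
  rw [← deriv_comp_add_const, hg.funext]

theorem exists_lipschitzWith_of_periodic {E : Type*} [NormedAddCommGroup E] [NormedSpace ℝ E]
    {g : ℝ → E} (hg : ContDiff ℝ 1 g) (hp : Function.Periodic g (2 * π)) :
    ∃ K, LipschitzWith K g := by
  obtain ⟨M, hM, h⟩ := exists_norm_le_of_periodic (hg.continuous_deriv le_rfl) (periodic_deriv hp)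
  exact ⟨⟨M, hM.le⟩, lipschitzWith_of_nnnorm_deriv_le (hg.differentiable one_ne_zero) h⟩

/-! ### Layer potentials -/

theorem hasFDerivAt_layer {γ : ℝ → Plane} (hγ : Continuous γ) {ψ : ℝ → ℝ} (hψ : Continuous ψ)
    {K : Plane → ℝ} {K' : Plane → Plane →L[ℝ] ℝ} {U V : Set Plane} (hU : IsOpen U)
    (hK : ∀ d ∈ V, HasFDerivAt K (K' d) d) (hK' : ContinuousOn K' V)
    (hUV : ∀ z ∈ U, ∀ σ, z - γ σ ∈ V) (a b : ℝ) {z : Plane} (hz : z ∈ U) :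
    HasFDerivAt (fun z => ∫ σ in a..b, ψ σ * K (z - γ σ)) (∫ σ in a..b, ψ σ • K' (z - γ σ)) z := by
  have hmaps : MapsTo (fun p : Plane × ℝ => p.1 - γ p.2) (U ×ˢ univ) V := fun p hp =>
    hUV _ hp.1 _
  have hsub : ContinuousOn (fun p : Plane × ℝ => p.1 - γ p.2) (U ×ˢ univ) := by fun_prop
  have hψ' : ContinuousOn (fun p : Plane × ℝ => ψ p.2) (U ×ˢ univ) := by fun_prop
  have hKc : ContinuousOn K V := fun d hd => (hK d hd).continuousAt.continuousWithinAt
  refine hasFDerivAt_intervalIntegral_param hU (k := fun z σ => ψ σ * K (z - γ σ))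
    (k' := fun z σ => ψ σ • K' (z - γ σ)) (hψ'.mul (hKc.comp hsub hmaps))
    (hψ'.smul (hK'.comp hsub hmaps)) (fun z hz σ => ?_) a b hz
  simpa using ((hK _ (hUV z hz σ)).comp z ((hasFDerivAt_id z).sub_const (γ σ))).const_mul (ψ σ)

theorem continuousOn_layer_fderiv {γ : ℝ → Plane} (hγ : Continuous γ) {ψ : ℝ → ℝ}
    (hψ : Continuous ψ) {K' : Plane → Plane →L[ℝ] ℝ} {U V : Set Plane}
    (hK' : ContinuousOn K' V) (hUV : ∀ z ∈ U, ∀ σ, z - γ σ ∈ V) (a b : ℝ) :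
    ContinuousOn (fun z => ∫ σ in a..b, ψ σ • K' (z - γ σ)) U := by
  have hmaps : MapsTo (fun p : Plane × ℝ => p.1 - γ p.2) (U ×ˢ univ) V := fun p hp =>
    hUV _ hp.1 _
  have hsub : ContinuousOn (fun p : Plane × ℝ => p.1 - γ p.2) (U ×ˢ univ) := by fun_prop
  have hψ' : ContinuousOn (fun p : Plane × ℝ => ψ p.2) (U ×ˢ univ) := by fun_prop
  exact continuousOn_intervalIntegral_param (hψ'.smul (hK'.comp hsub hmaps)) a b

theorem isClosed_range_of_periodic {γ : ℝ → Plane} (hγ : Continuous γ)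
    (hper : Function.Periodic γ (2 * π)) : IsClosed (range γ) :=
  (hper.compact_of_continuous (by positivity) hγ).isClosed

theorem hasFDerivAt_log_norm {d : Plane} (hd : d ≠ 0) :
    HasFDerivAt (fun d : Plane => log ‖d‖) ((‖d‖ ^ 2)⁻¹ • innerSL ℝ d) d := by
  have h1 : HasFDerivAt (fun d : Plane => ‖d‖ ^ 2) (2 • innerSL ℝ d) d :=
    (hasStrictFDerivAt_norm_sq d).hasFDerivAt
  have hd' : ‖d‖ ^ 2 ≠ 0 := by simpa using hd
  have h2 := (h1.log hd').const_mul (1 / 2)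
  have h3 : (fun d : Plane => 1 / 2 * log (‖d‖ ^ 2)) = fun d : Plane => log ‖d‖ := by
    funext d
    rw [log_pow]
    push_cast
    ring
  rw [h3] at h2
  convert! h2 using 1
  ext v
  simp
  ring

theorem continuousOn_log_norm_fderiv :
    ContinuousOn (fun d : Plane => (‖d‖ ^ 2)⁻¹ • innerSL ℝ d) {0}ᶜ := by
  have : Continuous fun d : Plane => innerSL ℝ d := (innerSL ℝ).continuous
  have h2 : ContinuousOn (fun d : Plane => (‖d‖ ^ 2)⁻¹) {0}ᶜ :=
    ContinuousOn.inv₀ (by fun_prop) fun d hd => by simpa using hd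
  exact h2.smul this.continuousOn

theorem abs_log_norm_le {c N u : ℝ} {d : Plane} (hc : 0 < c) (hu : u ≠ 0) (h1 : c * |u| ≤ ‖d‖)
    (h2 : ‖d‖ ≤ N) : |log ‖d‖| ≤ |log c| + |log u| + |log N| := by
  have hu' : 0 < |u| := abs_pos.2 hu
  have hd : 0 < ‖d‖ := lt_of_lt_of_le (by positivity) h1
  have h3 := log_le_log (by positivity) h1
  rw [log_mul hc.ne' hu'.ne', log_abs] at h3
  have h4 := log_le_log hd h2
  rw [abs_le]
  constructor
  · linarith [neg_abs_le (log c), neg_abs_le (log u), abs_nonneg (log N)]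
  · linarith [le_abs_self (log N), abs_nonneg (log c), abs_nonneg (log u)]

section LogLayer

variable {γ : ℝ → Plane} {s : ℝ} {ν : Plane} {ψ : ℝ → ℝ} {c N M : ℝ}

theorem logLayer_eq_shift (hper : Function.Periodic γ (2 * π))
    (hψp : Function.Periodic ψ (2 * π)) (z : Plane) (t : ℝ) :
    ∫ σ in (0 : ℝ)..(2 * π), ψ σ * log ‖z - γ σ‖
      = ∫ u in (-π)..π, ψ (t + u) * log ‖z - γ (t + u)‖ :=
  intervalIntegral_periodic_shift (g := fun σ => ψ σ * log ‖z - γ σ‖)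
    (fun σ => by simp only [hper σ, hψp σ]) t

theorem ae_ne_zero_mem_Icc : ∀ᵐ u : ℝ, u ∈ uIoc (-π) π → u ≠ 0 ∧ u ∈ Icc (-π) π := by
  filter_upwards [Measure.ae_ne volume (0 : ℝ)] with u hu hu'
  rw [uIoc_of_le (by linarith [pi_pos])] at hu'
  exact ⟨hu, Ioc_subset_Icc_self hu'⟩

theorem intervalIntegrable_log_bound (M c N : ℝ) (a b : ℝ) :
    IntervalIntegrable (fun u => M * (|log c| + |log u| + |log N|)) volume a b :=
  (((intervalIntegrable_const).add (intervalIntegral.intervalIntegrable_log'.abs)).add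
    intervalIntegrable_const).const_mul M

/-- The logarithmic single layer is continuous across the curve. -/
theorem continuousAt_logLayer (hγ : Continuous γ) (hper : Function.Periodic γ (2 * π))
    (hψ : Continuous ψ) (hψp : Function.Periodic ψ (2 * π)) (hc : 0 < c) {p : ℝ × ℝ}
    (hM : ∀ t, ‖ψ t‖ ≤ M)
    (hlow : ∀ᶠ p : ℝ × ℝ in 𝓝 p, ∀ u ∈ Icc (-π) π, c * |u| ≤ ‖γ p.1 + p.2 • ν - γ (p.1 + u)‖)
    (hup : ∀ᶠ p : ℝ × ℝ in 𝓝 p, ∀ u, ‖γ p.1 + p.2 • ν - γ (p.1 + u)‖ ≤ N) :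
    ContinuousAt (fun p : ℝ × ℝ =>
      ∫ σ in (0 : ℝ)..(2 * π), ψ σ * log ‖γ p.1 + p.2 • ν - γ σ‖) p := by
  simp only [fun p : ℝ × ℝ => logLayer_eq_shift hper hψp (γ p.1 + p.2 • ν) p.1]
  have hM0 : 0 ≤ M := (norm_nonneg _).trans (hM 0)
  refine intervalIntegral.continuousAt_of_dominated_interval
    (bound := fun u => M * (|log c| + |log u| + |log N|)) ?_ ?_
    (intervalIntegrable_log_bound _ _ _ _ _) ?_
  · refine .of_forall fun p => Measurable.aestronglyMeasurable ?_
    have h1 : Continuous fun u => ψ (p.1 + u) := by fun_prop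
    have h2 : Continuous fun u => ‖γ p.1 + p.2 • ν - γ (p.1 + u)‖ := by fun_prop
    exact h1.measurable.mul (measurable_log.comp h2.measurable)
  · filter_upwards [hlow, hup] with q hq1 hq2
    filter_upwards [ae_ne_zero_mem_Icc] with u hu hu'
    obtain ⟨hu0, huI⟩ := hu hu'
    rw [norm_mul]
    exact mul_le_mul (hM _) (abs_log_norm_le hc hu0 (hq1 u huI) (hq2 u)) (norm_nonneg _) hM0
  · filter_upwards [ae_ne_zero_mem_Icc] with u hu hu'
    obtain ⟨hu0, huI⟩ := hu hu'
    have hne : ‖γ p.1 + p.2 • ν - γ (p.1 + u)‖ ≠ 0 :=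
      (lt_of_lt_of_le (mul_pos hc (abs_pos.2 hu0)) (hlow.self_of_nhds u huI)).ne'
    have h1 : Continuous fun p : ℝ × ℝ => ψ (p.1 + u) := by fun_prop
    have h2 : Continuous fun p : ℝ × ℝ => ‖γ p.1 + p.2 • ν - γ (p.1 + u)‖ := by fun_prop
    exact h1.continuousAt.mul (h2.continuousAt.log hne)

theorem intervalIntegrable_logLayer (hγ : Continuous γ) (hper : Function.Periodic γ (2 * π))
    (hψ : Continuous ψ) (hψp : Function.Periodic ψ (2 * π)) (hc : 0 < c)
    (hlow : ∀ u ∈ Icc (-π) π, c * |u| ≤ ‖γ s - γ (s + u)‖) :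
    IntervalIntegrable (fun σ => ψ σ * log ‖γ s - γ σ‖) volume 0 (2 * π) := by
  obtain ⟨M, hM0, hM⟩ := exists_norm_le_of_periodic hψ hψp
  obtain ⟨B, hB0, hB⟩ := exists_norm_le_of_periodic hγ hper
  have h1 : IntervalIntegrable (fun u => ψ (s + u) * log ‖γ s - γ (s + u)‖) volume (-π) π := by
    refine (intervalIntegrable_log_bound M c (2 * B) _ _).mono_fun' ?_ ?_
    · refine Measurable.aestronglyMeasurable ?_
      have h1 : Continuous fun u => ψ (s + u) := by fun_prop
      have h2 : Continuous fun u => ‖γ s - γ (s + u)‖ := by fun_prop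
      exact h1.measurable.mul (measurable_log.comp h2.measurable)
    · rw [EventuallyLE, ae_restrict_iff' measurableSet_uIoc]
      filter_upwards [ae_ne_zero_mem_Icc] with u hu hu'
      obtain ⟨hu0, huI⟩ := hu hu'
      rw [norm_mul]
      refine mul_le_mul (hM _) (abs_log_norm_le hc hu0 (hlow u huI) ?_) (norm_nonneg _) hM0.le
      exact (norm_sub_le _ _).trans (by linarith [hB s, hB (s + u)])
  have h2 := h1.comp_add_right (-s)
  have hp : Function.Periodic (fun σ => ψ σ * log ‖γ s - γ σ‖) (2 * π) :=
    fun σ => by simp only [hper σ, hψp σ]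
  simp only [add_neg_cancel_comm_assoc, sub_neg_eq_add] at h2
  refine hp.intervalIntegrable (by positivity) (t := -π + s) ?_ _ _
  convert! h2 using 1
  ring

/-- Off the curve the total derivative of `σ ↦ log |z - γ σ|` may be subtracted from the
tangential derivative of the single layer, which makes the integrand only weakly singular when `z`
approaches the curve. -/
theorem logLayer_fderiv_apply_eq (hγ : ContDiff ℝ 1 γ) (hper : Function.Periodic γ (2 * π))
    (hψ : Continuous ψ) (hψp : Function.Periodic ψ (2 * π)) {z : Plane} (hz : z ∉ range γ)
    (t : ℝ) :
    (∫ σ in (0 : ℝ)..(2 * π), ψ σ • ((‖z - γ σ‖ ^ 2)⁻¹ • innerSL ℝ (z - γ σ))) (deriv γ t)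
      = ∫ u in (-π)..π, (‖z - γ (t + u)‖ ^ 2)⁻¹ *
          inner ℝ (z - γ (t + u)) (ψ (t + u) • deriv γ t - ψ t • deriv γ (t + u)) := by
  have hne : ∀ σ, z - γ σ ≠ 0 := fun σ h => hz ⟨σ, (sub_eq_zero.1 h).symm⟩
  have hcγ := hγ.continuous
  have hcγ' := hγ.continuous_deriv le_rfl
  have hinv : Continuous fun σ => (‖z - γ σ‖ ^ 2)⁻¹ :=
    Continuous.inv₀ (by fun_prop) fun σ => by simpa using hne σ
  have hsub : Continuous fun σ => z - γ σ := by fun_prop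
  have hsl : Continuous fun σ => innerSL ℝ (z - γ σ) := (innerSL ℝ).continuous.comp hsub
  have hint : Continuous fun σ => ψ σ • ((‖z - γ σ‖ ^ 2)⁻¹ • innerSL ℝ (z - γ σ)) :=
    hψ.smul (hinv.smul hsl)
  rw [ContinuousLinearMap.intervalIntegral_apply (hint.intervalIntegrable _ _)]
  rw [intervalIntegral_periodic_shift (t := t) (fun σ => by simp only [hper σ, hψp σ])]
  -- the integral of the total derivative vanishes
  have hlog : ∀ u, HasDerivAt (fun u => log ‖z - γ (t + u)‖)
      (-((‖z - γ (t + u)‖ ^ 2)⁻¹ * inner ℝ (z - γ (t + u)) (deriv γ (t + u)))) u := by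
    intro u
    have h1 : HasDerivAt (fun u => γ (t + u)) (deriv γ (t + u)) u :=
      ((hγ.differentiable one_ne_zero _).hasDerivAt).comp_const_add t u
    have h2 := (hasFDerivAt_log_norm (hne (t + u))).comp_hasDerivAt u (h1.const_sub z)
    refine h2.congr_deriv ?_
    simp only [_root_.smul_apply, innerSL_apply_apply, inner_neg_right, smul_eq_mul, mul_neg]
  have hshift : ∀ {f : ℝ → ℝ}, Continuous f → Continuous fun u => f (t + u) := fun hf =>
    hf.comp (by fun_prop)
  have hcont : Continuous fun u =>
      (‖z - γ (t + u)‖ ^ 2)⁻¹ * inner ℝ (z - γ (t + u)) (deriv γ (t + u)) :=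
    hshift (f := fun σ => (‖z - γ σ‖ ^ 2)⁻¹ * inner ℝ (z - γ σ) (deriv γ σ))
      (hinv.mul (hsub.inner hcγ'))
  have hzero : ∫ u in (-π)..π,
      (‖z - γ (t + u)‖ ^ 2)⁻¹ * inner ℝ (z - γ (t + u)) (deriv γ (t + u)) = 0 := by
    have h := intervalIntegral.integral_eq_sub_of_hasDerivAt (a := -π) (b := π)
      (fun u _ => hlog u) (hcont.neg.intervalIntegrable _ _)
    have hends : γ (t + π) = γ (t + -π) := by
      rw [← hper (t + -π)]
      congr 1
      ring
    rw [intervalIntegral.integral_neg, hends, sub_self, neg_eq_zero] at h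
    exact h
  have hsplit : ∀ u, (‖z - γ (t + u)‖ ^ 2)⁻¹ *
      inner ℝ (z - γ (t + u)) (ψ (t + u) • deriv γ t - ψ t • deriv γ (t + u))
      = (ψ (t + u) • ((‖z - γ (t + u)‖ ^ 2)⁻¹ • innerSL ℝ (z - γ (t + u)))) (deriv γ t)
        - ψ t * ((‖z - γ (t + u)‖ ^ 2)⁻¹ * inner ℝ (z - γ (t + u)) (deriv γ (t + u))) := by
    intro u
    simp only [inner_sub_right, inner_smul_right, _root_.smul_apply,
      innerSL_apply_apply, smul_eq_mul]
    ring
  simp only [hsplit]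
  rw [intervalIntegral.integral_sub, intervalIntegral.integral_const_mul, hzero, mul_zero,
    sub_zero]
  · refine Continuous.intervalIntegrable ?_ _ _
    refine hshift (f := fun σ => (ψ σ • ((‖z - γ σ‖ ^ 2)⁻¹ • innerSL ℝ (z - γ σ))) (deriv γ t)) ?_
    exact (hψ.smul (hinv.smul hsl)).clm_apply continuous_const
  · exact (hcont.const_mul _).intervalIntegrable _ _

/-- The tangential derivative of the logarithmic single layer with Hölder continuous density is
continuous across the curve. -/
theorem hasTangentialTrace_logLayer (hγ : ContDiff ℝ 2 γ) (hper : Function.Periodic γ (2 * π))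
    (hreg : deriv γ s ≠ 0) (hinj : ∀ t, γ s = γ t → ∃ k : ℤ, t = s + k * (2 * π))
    (hν0 : ν ≠ 0) (hν : inner ℝ (deriv γ s) ν = 0) (hψp : Function.Periodic ψ (2 * π))
    {C α : ℝ≥0} (hα : 0 < α) (hψα : HolderWith C α ψ) :
    HasTangentialTrace γ s ν (fun z => ∫ σ in (0 : ℝ)..(2 * π), ψ σ * log ‖z - γ σ‖) := by
  have hγ1 : ContDiff ℝ 1 γ := hγ.of_le (by norm_num)
  have hcγ := hγ.continuous
  have hcγ' := hγ1.continuous_deriv le_rfl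
  have hψ : Continuous ψ := hψα.continuous hα
  obtain ⟨M, hM0, hM⟩ := exists_norm_le_of_periodic hψ hψp
  obtain ⟨B, hB0, hB⟩ := exists_norm_le_of_periodic hcγ hper
  obtain ⟨B₁, hB₁0, hB₁⟩ := exists_norm_le_of_periodic hcγ' (periodic_deriv hper)
  obtain ⟨L, hL⟩ := exists_lipschitzWith_of_periodic
    ((contDiff_succ_iff_deriv (n := 1)).1 hγ).2.2 (periodic_deriv hper)
  obtain ⟨c, hc, hlow⟩ := eventually_mul_abs_le_norm_chord hγ1 hreg hinj hν
  have hup : ∀ᶠ p : ℝ × ℝ in 𝓝 (s, 0), ∀ u,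
      ‖γ p.1 + p.2 • ν - γ (p.1 + u)‖ ≤ B + ‖ν‖ + B := by
    have : ContinuousAt (fun p : ℝ × ℝ => |p.2|) (s, 0) := by fun_prop
    filter_upwards [this.eventually (gt_mem_nhds (show |((s, 0) : ℝ × ℝ).2| < 1 by simp))]
      with p hp u
    refine (norm_sub_le _ _).trans (add_le_add ((norm_add_le _ _).trans (add_le_add (hB _) ?_))
      (hB _))
    rw [norm_smul, Real.norm_eq_abs]
    exact mul_le_of_le_one_left (norm_nonneg _) hp.le
  refine ⟨fun p => ∫ u in (-π)..π, (‖γ p.1 + p.2 • ν - γ (p.1 + u)‖ ^ 2)⁻¹ *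
    inner ℝ (γ p.1 + p.2 • ν - γ (p.1 + u))
      (ψ (p.1 + u) • deriv γ p.1 - ψ p.1 • deriv γ (p.1 + u)), ?_⟩
  filter_upwards [eventually_eventually_nhds.2 hlow, eventually_eventually_nhds.2 hup]
    with p hlow hup
  refine ⟨?_, continuousAt_logLayer hcγ hper hψ hψp hc hM hlow hup, fun hp0 => ?_⟩
  · refine intervalIntegral.continuousAt_of_dominated_interval
      (bound := fun u => C * B₁ / c * |u| ^ ((α : ℝ) - 1) + M * L / c) ?_ ?_ ?_ ?_
    · refine .of_forall fun p => Measurable.aestronglyMeasurable ?_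
      have h1 : Continuous fun u => ‖γ p.1 + p.2 • ν - γ (p.1 + u)‖ ^ 2 := by fun_prop
      have h2 : Continuous fun u => inner ℝ (γ p.1 + p.2 • ν - γ (p.1 + u))
          (ψ (p.1 + u) • deriv γ p.1 - ψ p.1 • deriv γ (p.1 + u)) := by fun_prop
      exact h1.measurable.inv.mul h2.measurable
    · filter_upwards [hlow] with q hq
      filter_upwards [ae_ne_zero_mem_Icc] with u hu hu'
      obtain ⟨hu0, huI⟩ := hu hu'
      have hu0' : 0 < |u| := abs_pos.2 hu0
      set d := γ q.1 + q.2 • ν - γ (q.1 + u) with hd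
      have hd1 : c * |u| ≤ ‖d‖ := hq u huI
      have hd0 : 0 < ‖d‖ := lt_of_lt_of_le (by positivity) hd1
      have hE : ‖ψ (q.1 + u) • deriv γ q.1 - ψ q.1 • deriv γ (q.1 + u)‖
          ≤ C * |u| ^ (α : ℝ) * B₁ + M * (L * |u|) := by
        have h1 : ψ (q.1 + u) • deriv γ q.1 - ψ q.1 • deriv γ (q.1 + u)
            = (ψ (q.1 + u) - ψ q.1) • deriv γ q.1
              + ψ q.1 • (deriv γ q.1 - deriv γ (q.1 + u)) := by
          rw [sub_smul, smul_sub]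
          abel
        rw [h1]
        refine (norm_add_le _ _).trans ?_
        rw [norm_smul, norm_smul]
        have h2 := hψα.dist_le (q.1 + u) q.1
        have h3 := hL.dist_le_mul q.1 (q.1 + u)
        rw [Real.dist_eq, dist_eq_norm, add_sub_cancel_left] at h2
        rw [dist_eq_norm, Real.dist_eq, sub_add_cancel_left, abs_neg] at h3
        gcongr
        · exact h2
        · exact hB₁ _
        · exact hM _
      rw [norm_mul, norm_inv, norm_pow, norm_norm]
      calc (‖d‖ ^ 2)⁻¹ * ‖inner ℝ d (ψ (q.1 + u) • deriv γ q.1 - ψ q.1 • deriv γ (q.1 + u))‖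
          ≤ (‖d‖ ^ 2)⁻¹ * (‖d‖ * (C * |u| ^ (α : ℝ) * B₁ + M * (L * |u|))) := by
            gcongr
            exact (norm_inner_le_norm _ _).trans (by gcongr)
        _ = (C * |u| ^ (α : ℝ) * B₁ + M * (L * |u|)) / ‖d‖ := by field_simp
        _ ≤ (C * |u| ^ (α : ℝ) * B₁ + M * (L * |u|)) / (c * |u|) := by gcongr
        _ = C * B₁ / c * |u| ^ ((α : ℝ) - 1) + M * L / c := by
            rw [rpow_sub_one hu0'.ne']
            field_simp
    · exact ((intervalIntegrable_abs_rpow (by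
        have : (0 : ℝ) < α := by exact_mod_cast hα
        linarith) _ _).const_mul _).add intervalIntegrable_const
    · filter_upwards [ae_ne_zero_mem_Icc] with u hu hu'
      obtain ⟨hu0, huI⟩ := hu hu'
      have hne : ‖γ p.1 + p.2 • ν - γ (p.1 + u)‖ ^ 2 ≠ 0 := pow_ne_zero 2
        (lt_of_lt_of_le (mul_pos hc (abs_pos.2 hu0)) (hlow.self_of_nhds u huI)).ne'
      have h1 : Continuous fun p : ℝ × ℝ => ‖γ p.1 + p.2 • ν - γ (p.1 + u)‖ ^ 2 := by fun_prop
      have h2 : Continuous fun p : ℝ × ℝ => inner ℝ (γ p.1 + p.2 • ν - γ (p.1 + u))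
          (ψ (p.1 + u) • deriv γ p.1 - ψ p.1 • deriv γ (p.1 + u)) := by fun_prop
      exact (h1.continuousAt.inv₀ hne).mul h2.continuousAt
  · have hz := add_smul_notMem_range hper hν0 hc hlow.self_of_nhds hp0
    refine ⟨_, hasFDerivAt_layer (U := (range γ)ᶜ) hcγ hψ
      (isClosed_range_of_periodic hcγ hper).isOpen_compl
      (fun d hd => hasFDerivAt_log_norm hd) continuousOn_log_norm_fderiv
      (fun z hz σ h => hz ⟨σ, (sub_eq_zero.1 h).symm⟩) _ _ hz, ?_⟩
    exact logLayer_fderiv_apply_eq hγ1 hper hψ hψp hz p.1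

end LogLayer

/-! ### Power series with coefficients `O(1 / n!)` -/

/-- The power series with coefficients `a`. -/
noncomputable def powerSum (a : ℕ → ℝ) (t : ℝ) : ℝ := ∑' n, a n * t ^ n

/-- The coefficients are `O(1 / n!)`, so that `powerSum a` is entire. -/
def FactorialDecay (a : ℕ → ℝ) : Prop := ∃ C, ∀ n, |a n| ≤ C / n !

/-- The coefficients of the derivative of a power series. -/
def derivCoeff (a : ℕ → ℝ) (n : ℕ) : ℝ := (n + 1) * a (n + 1)

namespace FactorialDecay

variable {a b : ℕ → ℝ}

theorem derivCoeff (ha : FactorialDecay a) : FactorialDecay (derivCoeff a) := by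
  obtain ⟨C, hC⟩ := ha
  refine ⟨C, fun n => ?_⟩
  rw [LaguerreBIE.derivCoeff, abs_mul, abs_of_nonneg (by positivity : (0 : ℝ) ≤ n + 1)]
  calc ((n : ℝ) + 1) * |a (n + 1)| ≤ (n + 1) * (C / (n + 1)!) := by gcongr; exact hC _
    _ = C / n ! := by
      rw [Nat.factorial_succ]
      push_cast
      field_simp

theorem summable (ha : FactorialDecay a) (t : ℝ) : Summable fun n => a n * t ^ n := by
  obtain ⟨C, hC⟩ := ha
  refine Summable.of_norm_bounded ((Real.summable_pow_div_factorial |t|).mul_left C) fun n => ?_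
  rw [norm_mul, norm_pow, Real.norm_eq_abs, Real.norm_eq_abs]
  calc |a n| * |t| ^ n ≤ C / n ! * |t| ^ n := by gcongr; exact hC n
    _ = C * (|t| ^ n / n !) := by ring

theorem hasDerivAt (ha : FactorialDecay a) (t : ℝ) :
    HasDerivAt (powerSum a) (powerSum (LaguerreBIE.derivCoeff a) t) t := by
  obtain ⟨C, hC⟩ := id ha
  have hC0 : 0 ≤ C := by simpa using (abs_nonneg _).trans (hC 0)
  -- any ball around `0` that contains `t` will do
  set R := |t| + 1 with hR
  have hR0 : 0 ≤ R := by positivity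
  have hu : Summable fun n : ℕ => C * (n * R ^ (n - 1) / n !) := by
    refine Summable.mul_left C ((summable_nat_add_iff 1).1 ?_)
    refine (Real.summable_pow_div_factorial R).congr fun n => ?_
    rw [Nat.factorial_succ]
    push_cast
    field_simp
  have h := hasDerivAt_tsum_of_isPreconnected (t := Metric.ball (0 : ℝ) R) (y₀ := 0) (y := t)
    (g := fun n y => a n * y ^ n) (g' := fun n y => a n * (n * y ^ (n - 1))) hu
    Metric.isOpen_ball (convex_ball _ _).isPreconnected
    (fun n y _ => (hasDerivAt_pow n y).const_mul (a n)) (fun n y hy => ?_)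
    (by simp [hR]; positivity) (ha.summable 0) (by simp [hR])
  · refine h.congr_deriv ?_
    have hs : Summable fun n : ℕ => a n * (n * t ^ (n - 1)) := by
      refine (summable_nat_add_iff 1).1 ((ha.derivCoeff.summable t).congr fun n => ?_)
      rw [LaguerreBIE.derivCoeff, Nat.add_sub_cancel]
      push_cast
      ring
    rw [hs.tsum_eq_zero_add, powerSum]
    simp only [Nat.cast_zero, zero_mul, mul_zero, zero_add, Nat.add_sub_cancel]
    refine tsum_congr fun n => ?_
    rw [LaguerreBIE.derivCoeff]
    push_cast
    ring
  · rw [mem_ball_zero_iff, Real.norm_eq_abs] at hy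
    rw [norm_mul, norm_mul, norm_pow, Real.norm_eq_abs, Real.norm_eq_abs, Real.norm_eq_abs,
      Nat.abs_cast]
    calc |a n| * (n * |y| ^ (n - 1)) ≤ C / n ! * (n * R ^ (n - 1)) := by gcongr; exact hC n
      _ = _ := by ring

theorem contDiff (ha : FactorialDecay a) (N : ℕ) : ContDiff ℝ N (powerSum a) := by
  induction N generalizing a with
  | zero =>
    exact contDiff_zero.2 (Differentiable.continuous fun t => (ha.hasDerivAt t).differentiableAt)
  | succ N ih =>
    have h : deriv (powerSum a) = powerSum (LaguerreBIE.derivCoeff a) :=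
      funext fun t => (ha.hasDerivAt t).deriv
    push_cast
    refine contDiff_succ_iff_deriv.2 ⟨fun t => (ha.hasDerivAt t).differentiableAt, by simp, ?_⟩
    rw [h]
    exact ih ha.derivCoeff

theorem mul_powerSum_derivCoeff (ha : FactorialDecay a) (t : ℝ) :
    t * powerSum (LaguerreBIE.derivCoeff a) t = ∑' n : ℕ, n * a n * t ^ n := by
  have hs : Summable fun n : ℕ => n * a n * t ^ n := by
    refine (summable_nat_add_iff 1).1
      (((ha.derivCoeff.summable t).mul_left t).congr fun n => ?_)
    rw [LaguerreBIE.derivCoeff]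
    push_cast
    ring
  rw [hs.tsum_eq_zero_add, powerSum, ← tsum_mul_left]
  simp only [Nat.cast_zero, zero_mul, zero_add]
  refine tsum_congr fun n => ?_
  rw [LaguerreBIE.derivCoeff]
  push_cast
  ring

end FactorialDecay

/-! ### The modified Bessel and Hankel functions -/

/-- `I_0(z)` is the series with these coefficients at `(z / 2)²`. -/
noncomputable def coeffI0 (n : ℕ) : ℝ := 1 / (n ! : ℝ) ^ 2

/-- `I_1(z)` is `z / 2` times the series with these coefficients at `(z / 2)²`. -/
noncomputable def coeffI1 (n : ℕ) : ℝ := 1 / ((n ! : ℝ) * ((n + 1)! : ℝ))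

/-- The coefficients of `(I_0(z) - 1) / (z / 2)²`. -/
noncomputable def coeffI2 (n : ℕ) : ℝ := 1 / ((n + 1)! : ℝ) ^ 2

/-- The coefficients of the series in `K_0`. -/
noncomputable def coeffK0 (n : ℕ) : ℝ := (harmonic n : ℝ) / (n ! : ℝ) ^ 2

/-- The coefficients of the series in `K_1`. -/
noncomputable def coeffK1 (n : ℕ) : ℝ :=
  ((harmonic (n + 1) : ℝ) + (harmonic n : ℝ)) / ((n ! : ℝ) * ((n + 1)! : ℝ))

theorem one_le_factorial_cast (n : ℕ) : (1 : ℝ) ≤ n ! := by exact_mod_cast Nat.factorial_pos n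

theorem factorialDecay_coeffI0 : FactorialDecay coeffI0 := by
  refine ⟨1, fun n => ?_⟩
  have h := one_le_factorial_cast n
  rw [coeffI0, abs_of_nonneg (by positivity)]
  gcongr
  nlinarith

theorem factorialDecay_coeffI1 : FactorialDecay coeffI1 := by
  refine ⟨1, fun n => ?_⟩
  have h := one_le_factorial_cast n
  have h' := one_le_factorial_cast (n + 1)
  rw [coeffI1, abs_of_nonneg (by positivity)]
  gcongr
  nlinarith

theorem factorialDecay_coeffI2 : FactorialDecay coeffI2 := by
  refine ⟨1, fun n => ?_⟩
  have h := one_le_factorial_cast (n + 1)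
  have h' : (n ! : ℝ) ≤ ((n + 1)! : ℝ) := by exact_mod_cast Nat.factorial_le (Nat.le_succ n)
  rw [coeffI2, abs_of_nonneg (by positivity)]
  gcongr
  nlinarith

theorem harmonic_cast_succ (n : ℕ) :
    ((harmonic (n + 1) : ℚ) : ℝ) = (harmonic n : ℝ) + 1 / (n + 1) := by
  rw [harmonic_succ]
  push_cast
  ring

theorem harmonic_cast_nonneg (n : ℕ) : (0 : ℝ) ≤ (harmonic n : ℝ) := by
  induction n with
  | zero => simp
  | succ n ih =>
    rw [harmonic_cast_succ]
    positivity

theorem harmonic_cast_le_factorial (n : ℕ) : (harmonic n : ℝ) ≤ n ! := by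
  induction n with
  | zero => simp
  | succ n ih =>
    rw [harmonic_cast_succ, Nat.factorial_succ]
    push_cast
    have h := one_le_factorial_cast n
    rcases Nat.eq_zero_or_pos n with rfl | hn
    · simp
    · have h1 : (1 : ℝ) ≤ n := by exact_mod_cast hn
      have h2 : 1 / ((n : ℝ) + 1) ≤ 1 := by
        rw [div_le_one (by positivity)]
        linarith
      nlinarith

theorem factorialDecay_coeffK0 : FactorialDecay coeffK0 := by
  refine ⟨1, fun n => ?_⟩
  have h := one_le_factorial_cast n
  have h1 := harmonic_cast_nonneg n
  rw [coeffK0, abs_of_nonneg (by positivity), div_le_div_iff₀ (by positivity) (by positivity)]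
  nlinarith [harmonic_cast_le_factorial n]

theorem factorialDecay_coeffK1 : FactorialDecay coeffK1 := by
  refine ⟨2, fun n => ?_⟩
  have h1 := harmonic_cast_nonneg n
  have h2 := harmonic_cast_nonneg (n + 1)
  have h3 : (harmonic n : ℝ) ≤ (harmonic (n + 1) : ℝ) := by
    rw [harmonic_cast_succ]
    have : (0 : ℝ) ≤ 1 / ((n : ℝ) + 1) := by positivity
    linarith
  have h4 := harmonic_cast_le_factorial (n + 1)
  rw [coeffK1, abs_of_nonneg (by positivity), div_le_div_iff₀ (by positivity) (by positivity)]
  have h5 : (harmonic (n + 1) : ℝ) + (harmonic n : ℝ) ≤ 2 * ((n + 1)! : ℝ) := by linarith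
  calc _ ≤ 2 * ((n + 1)! : ℝ) * n ! := by gcongr
    _ = _ := by ring

theorem derivCoeff_coeffI0 : derivCoeff coeffI0 = coeffI1 := by
  funext n
  rw [derivCoeff, coeffI0, coeffI1, Nat.factorial_succ]
  push_cast
  field_simp

theorem powerSum_coeffI0 (t : ℝ) : powerSum coeffI0 t = 1 + t * powerSum coeffI2 t := by
  rw [powerSum, (factorialDecay_coeffI0.summable t).tsum_eq_zero_add, powerSum, ← tsum_mul_left]
  congr 1
  · simp [coeffI0]
  · refine tsum_congr fun n => ?_
    rw [coeffI0, coeffI2]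
    ring

theorem mul_powerSum_derivCoeff_coeffI1 (t : ℝ) :
    t * powerSum (derivCoeff coeffI1) t = powerSum coeffI0 t - powerSum coeffI1 t := by
  rw [factorialDecay_coeffI1.mul_powerSum_derivCoeff, powerSum, powerSum,
    ← (factorialDecay_coeffI0.summable t).tsum_sub (factorialDecay_coeffI1.summable t)]
  refine tsum_congr fun n => ?_
  rw [coeffI0, coeffI1, Nat.factorial_succ]
  push_cast
  field_simp
  ring

theorem powerSum_derivCoeff_coeffK0 (t : ℝ) :
    2 * powerSum (derivCoeff coeffK0) t = powerSum coeffK1 t + powerSum coeffI2 t := by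
  rw [powerSum, powerSum, powerSum,
    ← (factorialDecay_coeffK1.summable t).tsum_add (factorialDecay_coeffI2.summable t),
    ← tsum_mul_left]
  refine tsum_congr fun n => ?_
  rw [derivCoeff, coeffK0, coeffK1, coeffI2, harmonic_cast_succ, Nat.factorial_succ]
  push_cast
  field_simp
  ring

theorem mul_powerSum_derivCoeff_coeffK1 (t : ℝ) :
    t * powerSum (derivCoeff coeffK1) t
      = 2 * powerSum coeffK0 t + powerSum coeffI1 t - powerSum coeffK1 t := by
  rw [factorialDecay_coeffK1.mul_powerSum_derivCoeff, powerSum, powerSum, powerSum,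
    ← tsum_mul_left, ← ((factorialDecay_coeffK0.summable t).mul_left 2).tsum_add
      (factorialDecay_coeffI1.summable t),
    ← (((factorialDecay_coeffK0.summable t).mul_left 2).add
      (factorialDecay_coeffI1.summable t)).tsum_sub (factorialDecay_coeffK1.summable t)]
  refine tsum_congr fun n => ?_
  rw [coeffK0, coeffK1, coeffI1, harmonic_cast_succ, Nat.factorial_succ]
  push_cast
  field_simp
  ring

theorem besselI0_eq (z : ℝ) : besselI0 z = powerSum coeffI0 ((z / 2) ^ 2) := by
  simp only [besselI0, powerSum, coeffI0, pow_mul]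

theorem besselI1_eq (z : ℝ) : besselI1 z = z / 2 * powerSum coeffI1 ((z / 2) ^ 2) := by
  rw [besselI1, powerSum, ← tsum_mul_left]
  refine tsum_congr fun n => ?_
  rw [coeffI1, pow_succ, pow_mul]
  ring

theorem besselK0_eq (z : ℝ) : besselK0 z =
    -(log (z / 2) + eulerMascheroniConstant) * powerSum coeffI0 ((z / 2) ^ 2)
      + powerSum coeffK0 ((z / 2) ^ 2) := by
  rw [besselK0, besselI0_eq]
  simp only [powerSum, coeffK0, pow_mul]

theorem besselK1_eq (z : ℝ) : besselK1 z = 1 / z +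
    (log (z / 2) + eulerMascheroniConstant) * (z / 2 * powerSum coeffI1 ((z / 2) ^ 2))
      - 1 / 2 * (z / 2 * powerSum coeffK1 ((z / 2) ^ 2)) := by
  rw [besselK1, besselI1_eq]
  congr 2
  rw [powerSum, ← tsum_mul_left]
  refine tsum_congr fun n => ?_
  rw [coeffK1, pow_succ, pow_mul]
  ring

/-- `K_0(g √ρ)` as a function of `ρ > 0`. -/
noncomputable def profileK0 (g ρ : ℝ) : ℝ :=
  -(1 / 2 * log ρ + (log (g / 2) + eulerMascheroniConstant)) * powerSum coeffI0 (g ^ 2 / 4 * ρ)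
    + powerSum coeffK0 (g ^ 2 / 4 * ρ)

/-- `√ρ K_1(g √ρ)` as a function of `ρ > 0`. -/
noncomputable def profileK1 (g ρ : ℝ) : ℝ :=
  1 / g + (1 / 2 * log ρ + (log (g / 2) + eulerMascheroniConstant)) *
      (g / 2 * ρ * powerSum coeffI1 (g ^ 2 / 4 * ρ))
    - g / 4 * ρ * powerSum coeffK1 (g ^ 2 / 4 * ρ)

theorem log_mul_div_two {g r : ℝ} (hg : 0 < g) (hr : 0 < r) :
    log (g * r / 2) = 1 / 2 * log (r ^ 2) + log (g / 2) := by
  rw [log_pow, show g * r / 2 = r * (g / 2) by ring, log_mul hr.ne' (by positivity)]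
  push_cast
  ring

theorem besselK0_mul {g r : ℝ} (hg : 0 < g) (hr : 0 < r) :
    besselK0 (g * r) = profileK0 g (r ^ 2) := by
  rw [besselK0_eq, profileK0, log_mul_div_two hg hr,
    show (g * r / 2) ^ 2 = g ^ 2 / 4 * r ^ 2 by ring, add_assoc]

theorem mul_besselK1_mul {g r : ℝ} (hg : 0 < g) (hr : 0 < r) :
    r * besselK1 (g * r) = profileK1 g (r ^ 2) := by
  rw [besselK1_eq, profileK1, log_mul_div_two hg hr,
    show (g * r / 2) ^ 2 = g ^ 2 / 4 * r ^ 2 by ring, add_assoc]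
  field_simp
  ring

theorem hasDerivAt_powerSum_mul {a : ℕ → ℝ} (ha : FactorialDecay a) (m ρ : ℝ) :
    HasDerivAt (fun ρ => powerSum a (m * ρ)) (m * powerSum (derivCoeff a) (m * ρ)) ρ := by
  have h := (ha.hasDerivAt (m * ρ)).comp ρ ((hasDerivAt_id ρ).const_mul m)
  refine h.congr_deriv ?_
  simp [mul_comm]

/-- The relation `K_0' = -K_1`. -/
theorem hasDerivAt_profileK0 {g ρ : ℝ} (hg : 0 < g) (hρ : 0 < ρ) :
    HasDerivAt (profileK0 g) (-(g / 2) * profileK1 g ρ / ρ) ρ := by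
  have h := ((((hasDerivAt_log hρ.ne').const_mul (1 / 2)).add_const
    (log (g / 2) + eulerMascheroniConstant)).neg.mul
      (hasDerivAt_powerSum_mul factorialDecay_coeffI0 (g ^ 2 / 4) ρ)).add
    (hasDerivAt_powerSum_mul factorialDecay_coeffK0 (g ^ 2 / 4) ρ)
  refine h.congr_deriv ?_
  simp only [profileK1, Pi.neg_apply]
  have h1 := powerSum_derivCoeff_coeffK0 (g ^ 2 / 4 * ρ)
  have h2 := powerSum_coeffI0 (g ^ 2 / 4 * ρ)
  rw [derivCoeff_coeffI0, eq_div_iff hρ.ne',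
    show powerSum (derivCoeff coeffK0) (g ^ 2 / 4 * ρ)
      = (powerSum coeffK1 (g ^ 2 / 4 * ρ) + powerSum coeffI2 (g ^ 2 / 4 * ρ)) / 2 by linarith, h2]
  field_simp
  ring

/-- The relation `(z K_1)' = -z K_0`. -/
theorem hasDerivAt_profileK1 {g ρ : ℝ} (hρ : 0 < ρ) :
    HasDerivAt (profileK1 g) (-(g / 2) * profileK0 g ρ) ρ := by
  have hlin : ∀ m : ℝ, HasDerivAt (fun ρ : ℝ => m * ρ) m ρ := fun m => by
    simpa using (hasDerivAt_id ρ).const_mul m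
  have h := ((((((hasDerivAt_log hρ.ne').const_mul (1 / 2)).add_const
    (log (g / 2) + eulerMascheroniConstant)).mul ((hlin (g / 2)).mul
      (hasDerivAt_powerSum_mul factorialDecay_coeffI1 (g ^ 2 / 4) ρ))).const_add (1 / g))).sub
    ((hlin (g / 4)).mul (hasDerivAt_powerSum_mul factorialDecay_coeffK1 (g ^ 2 / 4) ρ))
  refine h.congr_deriv ?_
  simp only [profileK0, Pi.mul_apply]
  have h1 := mul_powerSum_derivCoeff_coeffI1 (g ^ 2 / 4 * ρ)
  have h2 := mul_powerSum_derivCoeff_coeffK1 (g ^ 2 / 4 * ρ)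
  set L := 1 / 2 * log ρ + (log (g / 2) + eulerMascheroniConstant)
  have h3 : 1 / 2 * ρ⁻¹ * (g / 2 * ρ * powerSum coeffI1 (g ^ 2 / 4 * ρ))
      = g / 4 * powerSum coeffI1 (g ^ 2 / 4 * ρ) := by
    field_simp
    ring
  rw [h3]
  linear_combination L * (g / 2) * h1 - g / 4 * h2

/-! ### The fundamental sequence as a function of the squared distance -/

theorem coeff_eq_zero (κ c : ℝ) {n k : ℕ} (h : n < k) : coeff κ c n k = 0 := by
  obtain ⟨k, rfl⟩ : ∃ l, k = l + 1 := ⟨k - 1, by omega⟩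
  rw [coeff, if_neg (by omega), dif_neg (by omega)]

theorem gamma_pos {κ c : ℝ} (hκ : 0 < κ) (hc : 0 < c) : 0 < gamma κ c := div_pos hκ hc

/-- The recurrence for the coefficients, for all indices at once: coefficients outside the
triangle vanish. -/
theorem coeff_recurrence {κ c : ℝ} (hκ : 0 < κ) (hc : 0 < c) (n k : ℕ) :
    2 * gamma κ c * ((k : ℝ) + 1) * coeff κ c n (k + 1) =
      4 * (((k + 2) / 2 : ℕ) : ℝ) ^ 2 * coeff κ c n (k + 2)
        - ∑ m ∈ Finset.range n, beta κ c (n - m) * coeff κ c m k := by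
  have hg := gamma_pos hκ hc
  rcases lt_trichotomy (k + 1) n with h | h | h
  · rw [coeff_rec κ c n (k + 1) (by omega) h]
    have hsum : ∑ m ∈ Finset.Icc (k + 1 - 1) (n - 1), beta κ c (n - m) * coeff κ c m (k + 1 - 1)
        = ∑ m ∈ Finset.range n, beta κ c (n - m) * coeff κ c m k := by
      rw [Nat.add_sub_cancel]
      refine Finset.sum_subset (fun m hm => ?_) fun m hm hm' => ?_
      · rw [Finset.mem_Icc] at hm
        rw [Finset.mem_range]
        omega
      · rw [Finset.mem_range] at hm
        rw [Finset.mem_Icc] at hm'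
        rw [coeff_eq_zero κ c (by omega), mul_zero]
    rw [hsum]
    push_cast
    field_simp
  · subst h
    rw [coeff_self κ c (k + 1) (by omega), coeff_eq_zero κ c (by omega : k + 1 < k + 2),
      Finset.sum_range_succ, Finset.sum_eq_zero fun m hm => by
        rw [coeff_eq_zero κ c (Finset.mem_range.1 hm), mul_zero], Nat.add_sub_cancel,
      Nat.add_sub_cancel_left]
    push_cast
    field_simp
    ring
  · rw [coeff_eq_zero κ c h, coeff_eq_zero κ c (by omega : n < k + 2),
      Finset.sum_eq_zero fun m hm => by
        rw [coeff_eq_zero κ c (by rw [Finset.mem_range] at hm; omega), mul_zero]]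
    ring

/-- The polynomial `V` with `v_n(r) = V(r²)`. -/
noncomputable def evenPoly (κ c : ℝ) (n : ℕ) : Polynomial ℝ :=
  ∑ k ∈ Finset.range (n / 2 + 1), Polynomial.monomial k (coeff κ c n (2 * k))

/-- The polynomial `W` with `w_n(r) = r W(r²)`. -/
noncomputable def oddPoly (κ c : ℝ) (n : ℕ) : Polynomial ℝ :=
  ∑ k ∈ Finset.range ((n - 1) / 2 + 1), Polynomial.monomial k (coeff κ c n (2 * k + 1))

theorem evenPoly_coeff (κ c : ℝ) (n k : ℕ) :
    (evenPoly κ c n).coeff k = coeff κ c n (2 * k) := by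
  simp only [evenPoly, Polynomial.finsetSum_coeff, Polynomial.coeff_monomial,
    Finset.sum_ite_eq', Finset.mem_range]
  split_ifs with h
  · rfl
  · rw [coeff_eq_zero κ c (by omega)]

theorem oddPoly_coeff (κ c : ℝ) (n k : ℕ) :
    (oddPoly κ c n).coeff k = coeff κ c n (2 * k + 1) := by
  simp only [oddPoly, Polynomial.finsetSum_coeff, Polynomial.coeff_monomial,
    Finset.sum_ite_eq', Finset.mem_range]
  split_ifs with h
  · rfl
  · rw [coeff_eq_zero κ c (by omega)]

theorem polyV_eq (κ c : ℝ) (n : ℕ) (r : ℝ) : polyV κ c n r = (evenPoly κ c n).eval (r ^ 2) := by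
  simp only [polyV, evenPoly, Polynomial.eval_finsetSum, Polynomial.eval_monomial, pow_mul]

theorem polyW_eq (κ c : ℝ) (n : ℕ) (r : ℝ) :
    polyW κ c n r = r * (oddPoly κ c n).eval (r ^ 2) := by
  have h : ∑ k ∈ Finset.range ((n - 1) / 2 + 1), coeff κ c n (2 * k + 1) * r ^ (2 * k + 1)
      = r * (oddPoly κ c n).eval (r ^ 2) := by
    simp only [oddPoly, Polynomial.eval_finsetSum, Polynomial.eval_monomial, Finset.mul_sum,
      pow_succ r, pow_mul]
    refine Finset.sum_congr rfl fun k _ => by ring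
  rw [polyW]
  split_ifs with hn
  · rw [← h, hn]
    simp [coeff_eq_zero]
  · exact h

open Polynomial in
theorem evenPoly_identity {κ c : ℝ} (hκ : 0 < κ) (hc : 0 < c) (n : ℕ) :
    4 * derivative (X * derivative (evenPoly κ c n))
        - C (2 * gamma κ c) * (2 * derivative (X * oddPoly κ c n) - oddPoly κ c n)
      = ∑ m ∈ Finset.range n, C (beta κ c (n - m)) * evenPoly κ c m := by
  ext k
  have h4 : (4 : ℝ[X]) = C 4 := rfl
  have h2 : (2 : ℝ[X]) = C 2 := rfl
  simp only [h4, h2, coeff_sub, coeff_C_mul, coeff_derivative, coeff_X_mul, evenPoly_coeff,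
    oddPoly_coeff, finsetSum_coeff]
  have h := coeff_recurrence hκ hc n (2 * k)
  rw [show (2 * k + 2) / 2 = k + 1 by omega] at h
  rw [show 2 * (k + 1) = 2 * k + 2 by ring]
  push_cast at h ⊢
  linear_combination -h

open Polynomial in
theorem oddPoly_identity {κ c : ℝ} (hκ : 0 < κ) (hc : 0 < c) (n : ℕ) :
    4 * derivative (X * derivative (oddPoly κ c n))
        - C (4 * gamma κ c) * derivative (evenPoly κ c n)
      = ∑ m ∈ Finset.range n, C (beta κ c (n - m)) * oddPoly κ c m := by
  ext k
  have h4 : (4 : ℝ[X]) = C 4 := rfl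
  simp only [h4, coeff_sub, coeff_C_mul, coeff_derivative, coeff_X_mul, evenPoly_coeff,
    oddPoly_coeff, finsetSum_coeff]
  have h := coeff_recurrence hκ hc n (2 * k + 1)
  rw [show (2 * k + 1 + 2) / 2 = k + 1 by omega] at h
  rw [show 2 * (k + 1) = 2 * k + 1 + 1 by ring]
  push_cast at h ⊢
  linear_combination -h

/-- `Φ_n(x, y)` as a function of `ρ = |x - y|² > 0`. -/
noncomputable def profile (κ c : ℝ) (n : ℕ) (ρ : ℝ) : ℝ :=
  profileK0 (gamma κ c) ρ * (evenPoly κ c n).eval ρ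
    + profileK1 (gamma κ c) ρ * (oddPoly κ c n).eval ρ

theorem Phi_eq_profile {κ c : ℝ} (hκ : 0 < κ) (hc : 0 < c) (n : ℕ) {x y : Plane} (h : x ≠ y) :
    Phi κ c n x y = profile κ c n (‖x - y‖ ^ 2) := by
  have hr : 0 < ‖x - y‖ := norm_pos_iff.2 (sub_ne_zero.2 h)
  rw [Phi, profile, polyV_eq, polyW_eq, besselK0_mul (gamma_pos hκ hc) hr,
    ← mul_besselK1_mul (gamma_pos hκ hc) hr]
  ring

/-- The derivative of `profile`: by the Bessel relations `ρ F'` is again a combination of the two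
Hankel functions with polynomial coefficients. -/
theorem hasDerivAt_profile {κ c : ℝ} (hκ : 0 < κ) (hc : 0 < c) (n : ℕ) {ρ : ℝ} (hρ : 0 < ρ) :
    HasDerivAt (profile κ c n)
      ((profileK0 (gamma κ c) ρ * (Polynomial.X * (evenPoly κ c n).derivative
          - Polynomial.C (gamma κ c / 2) * (Polynomial.X * oddPoly κ c n)).eval ρ
        + profileK1 (gamma κ c) ρ * (Polynomial.X * (oddPoly κ c n).derivative
          - Polynomial.C (gamma κ c / 2) * evenPoly κ c n).eval ρ) / ρ) ρ := by
  have h := ((hasDerivAt_profileK0 (gamma_pos hκ hc) hρ).mul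
    ((evenPoly κ c n).hasDerivAt ρ)).add
    ((hasDerivAt_profileK1 (g := gamma κ c) hρ).mul ((oddPoly κ c n).hasDerivAt ρ))
  refine h.congr_deriv ?_
  simp only [Polynomial.eval_sub, Polynomial.eval_mul, Polynomial.eval_X, Polynomial.eval_C]
  field_simp
  ring

/-- The equation `ΔΦ_n = ∑_{k ≤ n} β_{n-k} Φ_k` away from the diagonal, in the variable `ρ`. -/
theorem profile_ode {κ c : ℝ} (hκ : 0 < κ) (hc : 0 < c) (n : ℕ) {ρ : ℝ} (hρ : 0 < ρ) :
    4 * (deriv (profile κ c n) ρ + ρ * deriv (deriv (profile κ c n)) ρ)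
      = ∑ k ∈ Finset.range (n + 1), beta κ c (n - k) * profile κ c k ρ := by
  set g := gamma κ c with hg
  have hg0 : 0 < g := gamma_pos hκ hc
  set P := Polynomial.X * (evenPoly κ c n).derivative
    - Polynomial.C (g / 2) * (Polynomial.X * oddPoly κ c n) with hP
  set Q := Polynomial.X * (oddPoly κ c n).derivative
    - Polynomial.C (g / 2) * evenPoly κ c n with hQ
  have hF : ∀ᶠ x in 𝓝 ρ, deriv (profile κ c n) x
      = (profileK0 g x * P.eval x + profileK1 g x * Q.eval x) / x := by
    filter_upwards [lt_mem_nhds hρ] with x hx using (hasDerivAt_profile hκ hc n hx).deriv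
  have hnum := ((hasDerivAt_profileK0 hg0 hρ).mul (P.hasDerivAt ρ)).add
    ((hasDerivAt_profileK1 (g := g) hρ).mul (Q.hasDerivAt ρ))
  have h2 := (hnum.div (hasDerivAt_id ρ) hρ.ne').congr_of_eventuallyEq hF
  rw [h2.deriv, hF.self_of_nhds]
  have hV := congrArg (Polynomial.eval ρ) (evenPoly_identity hκ hc n)
  have hW := congrArg (Polynomial.eval ρ) (oddPoly_identity hκ hc n)
  rw [Polynomial.eval_finsetSum] at hV hW
  have hsum : ∑ k ∈ Finset.range (n + 1), beta κ c (n - k) * profile κ c k ρ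
      = g ^ 2 * profile κ c n ρ
        + (profileK0 g ρ * ∑ m ∈ Finset.range n, beta κ c (n - m) * (evenPoly κ c m).eval ρ
        + profileK1 g ρ * ∑ m ∈ Finset.range n, beta κ c (n - m) * (oddPoly κ c m).eval ρ) := by
    rw [Finset.sum_range_succ, Nat.sub_self, ← gamma_sq, ← hg, Finset.mul_sum, Finset.mul_sum,
      ← Finset.sum_add_distrib, add_comm]
    congr 1
    refine Finset.sum_congr rfl fun k _ => ?_
    rw [profile]
    ring
  simp only [Polynomial.eval_mul, Polynomial.eval_C, Polynomial.eval_sub] at hV hW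
  rw [hsum, ← hV, ← hW, profile, hP, hQ]
  simp only [Polynomial.eval_mul, Polynomial.eval_C, Polynomial.eval_sub, Polynomial.eval_X,
    Polynomial.derivative_mul, Polynomial.derivative_X, Polynomial.derivative_sub,
    Polynomial.derivative_C, Polynomial.eval_add, Polynomial.eval_ofNat, one_mul, zero_mul,
    zero_add, id_eq, Pi.add_apply, Pi.mul_apply, ← hg]
  field_simp
  ring

theorem hasFDerivAt_norm_sq (d : Plane) :
    HasFDerivAt (fun d : Plane => ‖d‖ ^ 2) ((2 : ℝ) • innerSL ℝ d) d := by
  have h : HasFDerivAt (fun d : Plane => ‖d‖ ^ 2) (2 • innerSL ℝ d) d :=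
    (hasStrictFDerivAt_norm_sq d).hasFDerivAt
  convert! h using 1
  ext v
  simp [two_mul]

theorem continuous_innerSL : Continuous fun d : Plane => innerSL ℝ d := (innerSL ℝ).continuous

/-! ### The logarithmic singularity -/

/-- The function `|d|² log |d|²` is of class `C¹`. -/
theorem hasFDerivAt_norm_sq_mul_log (d : Plane) :
    HasFDerivAt (fun d : Plane => ‖d‖ ^ 2 * log (‖d‖ ^ 2))
      ((2 * (log (‖d‖ ^ 2) + 1)) • innerSL ℝ d) d := by
  rcases eq_or_ne d 0 with rfl | hd
  · rw [map_zero, smul_zero, hasFDerivAt_iff_isLittleO_nhds_zero]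
    have h0 : Tendsto (fun h : Plane => 2 * (‖h‖ * log ‖h‖)) (𝓝 0) (𝓝 0) := by
      have : Continuous fun h : Plane => 2 * (‖h‖ * log ‖h‖) :=
        continuous_const.mul (continuous_mul_log.comp continuous_norm)
      simpa using this.tendsto 0
    have h1 := (Asymptotics.isBigO_refl (fun h : Plane => ‖h‖) (𝓝 0)).mul_isLittleO
      ((Asymptotics.isLittleO_one_iff ℝ).2 h0)
    simp only [mul_one] at h1
    refine h1.of_norm_right.congr_left fun h => ?_
    simp only [zero_add, norm_zero, log_pow, _root_.zero_apply, sub_zero]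
    push_cast
    ring
  · have hd' : ‖d‖ ^ 2 ≠ 0 := by simpa using hd
    have h := (hasFDerivAt_norm_sq d).mul ((hasFDerivAt_norm_sq d).log hd')
    convert! h using 1
    ext v
    simp
    field_simp
    ring

theorem continuous_norm_sq_mul_log_fderiv :
    Continuous fun d : Plane => (2 * (log (‖d‖ ^ 2) + 1)) • innerSL ℝ d := by
  rw [continuous_iff_continuousAt]
  intro d
  rcases eq_or_ne d 0 with rfl | hd
  · have h0 : Tendsto (fun h : Plane => 4 * (‖h‖ * log ‖h‖)) (𝓝 0) (𝓝 0) := by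
      have : Continuous fun h : Plane => 4 * (‖h‖ * log ‖h‖) :=
        continuous_const.mul (continuous_mul_log.comp continuous_norm)
      simpa using this.tendsto 0
    have h1 : Tendsto (fun h : Plane => (2 * log (‖h‖ ^ 2)) • innerSL ℝ h) (𝓝 0) (𝓝 0) := by
      rw [tendsto_zero_iff_norm_tendsto_zero]
      refine h0.norm.congr' (.of_forall fun h => ?_) |>.trans (by simp)
      rw [norm_smul, innerSL_apply_norm, log_pow, norm_mul, norm_mul, norm_mul, norm_norm]
      simp only [Real.norm_eq_abs, abs_mul]
      norm_num
      ring
    have h2 : Tendsto (fun h : Plane => (2 : ℝ) • innerSL ℝ h) (𝓝 0) (𝓝 0) := by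
      have := (continuous_innerSL.tendsto 0).const_smul (2 : ℝ)
      simpa using this
    rw [ContinuousAt]
    have h3 := h1.add h2
    simp only [map_zero, smul_zero, add_zero] at h3 ⊢
    refine h3.congr fun h => ?_
    rw [← add_smul]
    ring_nf
  · have hd' : ‖d‖ ^ 2 ≠ 0 := by simpa using hd
    have h1 : ContinuousAt (fun d : Plane => ‖d‖ ^ 2) d := by fun_prop
    exact (((h1.log hd').add continuousAt_const).const_mul 2).smul continuous_innerSL.continuousAt

theorem contDiff_norm_sq_mul_log : ContDiff ℝ 1 fun d : Plane => ‖d‖ ^ 2 * log (‖d‖ ^ 2) :=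
  contDiff_one_iff_hasFDerivAt.2
    ⟨_, continuous_norm_sq_mul_log_fderiv, hasFDerivAt_norm_sq_mul_log⟩

/-- The function `A` in `profile ρ = -(1/2) log ρ (1 + ρ A(ρ)) + B(ρ)`. -/
noncomputable def logPart (κ c : ℝ) (n : ℕ) (ρ : ℝ) : ℝ :=
  gamma κ c ^ 2 / 4 * powerSum coeffI2 (gamma κ c ^ 2 / 4 * ρ) * (evenPoly κ c n).eval ρ
    + (evenPoly κ c n).divX.eval ρ
    - gamma κ c / 2 * powerSum coeffI1 (gamma κ c ^ 2 / 4 * ρ) * (oddPoly κ c n).eval ρ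

/-- The function `B` in `profile ρ = -(1/2) log ρ (1 + ρ A(ρ)) + B(ρ)`. -/
noncomputable def regularPart (κ c : ℝ) (n : ℕ) (ρ : ℝ) : ℝ :=
  (-(log (gamma κ c / 2) + eulerMascheroniConstant)
        * powerSum coeffI0 (gamma κ c ^ 2 / 4 * ρ)
      + powerSum coeffK0 (gamma κ c ^ 2 / 4 * ρ)) * (evenPoly κ c n).eval ρ
    + (1 / gamma κ c + (log (gamma κ c / 2) + eulerMascheroniConstant)
        * (gamma κ c / 2 * ρ * powerSum coeffI1 (gamma κ c ^ 2 / 4 * ρ))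
      - gamma κ c / 4 * ρ * powerSum coeffK1 (gamma κ c ^ 2 / 4 * ρ)) * (oddPoly κ c n).eval ρ

/-- The coefficient of the logarithm is `1` at `ρ = 0` for every `n`, because `a_{n,0} = 1`. -/
theorem profile_eq (κ c : ℝ) (n : ℕ) (ρ : ℝ) :
    profile κ c n ρ = -(1 / 2) * log ρ * (1 + ρ * logPart κ c n ρ) + regularPart κ c n ρ := by
  have hV : (evenPoly κ c n).eval ρ = 1 + ρ * (evenPoly κ c n).divX.eval ρ := by
    conv_lhs => rw [← Polynomial.divX_mul_X_add (evenPoly κ c n)]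
    simp [evenPoly_coeff, coeff_zero]
    ring
  have hI := powerSum_coeffI0 (gamma κ c ^ 2 / 4 * ρ)
  rw [profile, profileK0, profileK1, logPart, regularPart]
  linear_combination (-(1 / 2) * log ρ * (evenPoly κ c n).eval ρ) * hI - 1 / 2 * log ρ * hV

theorem contDiff_powerSum_mul {a : ℕ → ℝ} (ha : FactorialDecay a) (m : ℝ) :
    ContDiff ℝ 2 fun ρ => powerSum a (m * ρ) :=
  (ha.contDiff 2).comp (contDiff_const.mul contDiff_id)

theorem contDiff_polynomial_eval (p : Polynomial ℝ) : ContDiff ℝ 2 fun ρ => p.eval ρ := by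
  simpa using p.contDiff_aeval (𝕜 := ℝ) 2

theorem contDiff_logPart (κ c : ℝ) (n : ℕ) : ContDiff ℝ 2 (logPart κ c n) := by
  have h1 := contDiff_powerSum_mul factorialDecay_coeffI1 (gamma κ c ^ 2 / 4)
  have h2 := contDiff_powerSum_mul factorialDecay_coeffI2 (gamma κ c ^ 2 / 4)
  have hV := contDiff_polynomial_eval (evenPoly κ c n)
  have hV' := contDiff_polynomial_eval (evenPoly κ c n).divX
  have hW := contDiff_polynomial_eval (oddPoly κ c n)
  exact (((contDiff_const.mul h2).mul hV).add hV').sub ((contDiff_const.mul h1).mul hW)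

theorem contDiff_regularPart (κ c : ℝ) (n : ℕ) : ContDiff ℝ 2 (regularPart κ c n) := by
  have h1 := contDiff_powerSum_mul factorialDecay_coeffI0 (gamma κ c ^ 2 / 4)
  have h2 := contDiff_powerSum_mul factorialDecay_coeffI1 (gamma κ c ^ 2 / 4)
  have h3 := contDiff_powerSum_mul factorialDecay_coeffK0 (gamma κ c ^ 2 / 4)
  have h4 := contDiff_powerSum_mul factorialDecay_coeffK1 (gamma κ c ^ 2 / 4)
  have hV := contDiff_polynomial_eval (evenPoly κ c n)
  have hW := contDiff_polynomial_eval (oddPoly κ c n)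
  exact (((contDiff_const.mul h1).add h3).mul hV).add
    (((contDiff_const.add (contDiff_const.mul ((contDiff_const.mul contDiff_id).mul h2))).sub
      ((contDiff_const.mul contDiff_id).mul h4)).mul hW)

theorem contDiffOn_profile (κ c : ℝ) (n : ℕ) : ContDiffOn ℝ 2 (profile κ c n) (Ioi 0) := by
  have hlog : ContDiffOn ℝ 2 log (Ioi 0) :=
    contDiffOn_log.mono fun x hx => (ne_of_gt hx : x ≠ 0)
  have h1 := (contDiff_logPart κ c n).contDiffOn (s := Ioi 0)
  have h2 := (contDiff_regularPart κ c n).contDiffOn (s := Ioi 0)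
  refine ContDiffOn.congr (((contDiffOn_const (c := -(1 / 2))).mul hlog).mul
    ((contDiffOn_const (c := 1)).add (contDiffOn_id.mul h1)) |>.add h2) fun ρ _ => ?_
  exact profile_eq κ c n ρ

/-- The difference of `Φ_n(x, y)` and `-log |x - y|`, a `C¹` function of `x - y`. -/
noncomputable def regularKernel (κ c : ℝ) (n : ℕ) (d : Plane) : ℝ :=
  -(1 / 2) * (‖d‖ ^ 2 * log (‖d‖ ^ 2)) * logPart κ c n (‖d‖ ^ 2) + regularPart κ c n (‖d‖ ^ 2)

theorem profile_norm_sq (κ c : ℝ) (n : ℕ) (d : Plane) :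
    profile κ c n (‖d‖ ^ 2) = -log ‖d‖ + regularKernel κ c n d := by
  rw [profile_eq, regularKernel, log_pow]
  push_cast
  ring

theorem contDiff_regularKernel (κ c : ℝ) (n : ℕ) : ContDiff ℝ 1 (regularKernel κ c n) := by
  have hsq : ContDiff ℝ 1 fun d : Plane => ‖d‖ ^ 2 := contDiff_norm_sq ℝ
  have h1 := ((contDiff_logPart κ c n).of_le (m := 1) (by norm_num)).comp hsq
  have h2 := ((contDiff_regularPart κ c n).of_le (m := 1) (by norm_num)).comp hsq
  exact ((contDiff_const.mul contDiff_norm_sq_mul_log).mul h1).add h2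

/-! ### Radial kernels and the normal derivative of the double layer off the curve -/

/-- Rotation by a right angle, clockwise. -/
noncomputable def rotR : Plane →L[ℝ] Plane :=
  LinearMap.toContinuousLinearMap
    { toFun := fun v => !₂[v 1, -(v 0)]
      map_add' := fun v w => by
        ext i
        fin_cases i <;> simp
        ring
      map_smul' := fun a v => by
        ext i
        fin_cases i <;> simp }

theorem rotR_apply (v : Plane) : rotR v = !₂[v 1, -(v 0)] := rfl

theorem inner_rotR_rotR (a b : Plane) : inner ℝ (rotR a) (rotR b) = inner ℝ a b := by
  simp only [rotR_apply, PiLp.inner_apply, Fin.sum_univ_two, RCLike.inner_apply, conj_trivial]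
  simp
  ring

theorem inner_rotR_self (a : Plane) : inner ℝ a (rotR a) = 0 := by
  simp only [rotR_apply, PiLp.inner_apply, Fin.sum_univ_two, RCLike.inner_apply, conj_trivial]
  simp
  ring

/-- Expansion of `|d|² ⟨a, b⟩` in the orthogonal vectors `d` and its rotation. -/
theorem inner_rotR_mul_add (d a b : Plane) :
    inner ℝ d (rotR a) * inner ℝ d (rotR b) + inner ℝ d a * inner ℝ d b
      = ‖d‖ ^ 2 * inner ℝ a b := by
  rw [← real_inner_self_eq_norm_sq]
  simp only [rotR_apply, PiLp.inner_apply, Fin.sum_univ_two, RCLike.inner_apply, conj_trivial]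
  simp
  ring

section Radial

variable {F : ℝ → ℝ}

/-- The gradient of `d ↦ F(|d|²)`. -/
noncomputable def radialGrad (F : ℝ → ℝ) (d : Plane) : Plane →L[ℝ] ℝ :=
  (2 * deriv F (‖d‖ ^ 2)) • innerSL ℝ d

/-- The Hessian of `d ↦ F(|d|²)`, applied to the vector `b`. -/
noncomputable def radialHess (F : ℝ → ℝ) (d b : Plane) : Plane →L[ℝ] ℝ :=
  (2 * deriv F (‖d‖ ^ 2)) • innerSL ℝ b
    + (4 * deriv (deriv F) (‖d‖ ^ 2) * inner ℝ d b) • innerSL ℝ d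

theorem norm_sq_mem_Ioi {d : Plane} (hd : d ≠ 0) : ‖d‖ ^ 2 ∈ Ioi (0 : ℝ) :=
  pow_pos (norm_pos_iff.2 hd) 2

theorem contDiffOn_deriv_of_Ioi (hF : ContDiffOn ℝ 2 F (Ioi 0)) :
    ContDiffOn ℝ 1 (deriv F) (Ioi 0) :=
  ((contDiffOn_succ_iff_deriv_of_isOpen (n := 1) isOpen_Ioi).1 hF).2.2

theorem hasFDerivAt_radial (hF : ContDiffOn ℝ 2 F (Ioi 0)) {d : Plane} (hd : d ≠ 0) :
    HasFDerivAt (fun d : Plane => F (‖d‖ ^ 2)) (radialGrad F d) d := by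
  have h1 : HasDerivAt F (deriv F (‖d‖ ^ 2)) (‖d‖ ^ 2) :=
    ((hF.differentiableOn two_ne_zero).differentiableAt
      (isOpen_Ioi.mem_nhds (norm_sq_mem_Ioi hd))).hasDerivAt
  have h2 := h1.comp_hasFDerivAt d (hasFDerivAt_norm_sq d)
  convert! h2 using 1
  rw [radialGrad, smul_smul, mul_comm]

theorem hasFDerivAt_radialGrad (hF : ContDiffOn ℝ 2 F (Ioi 0)) {d : Plane} (hd : d ≠ 0)
    (b : Plane) : HasFDerivAt (fun d => radialGrad F d b) (radialHess F d b) d := by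
  have hF' := contDiffOn_deriv_of_Ioi hF
  have h1 : HasDerivAt (deriv F) (deriv (deriv F) (‖d‖ ^ 2)) (‖d‖ ^ 2) :=
    ((hF'.differentiableOn one_ne_zero).differentiableAt
      (isOpen_Ioi.mem_nhds (norm_sq_mem_Ioi hd))).hasDerivAt
  have h2 := (h1.comp_hasFDerivAt d (hasFDerivAt_norm_sq d)).const_mul 2
  have h3 : HasFDerivAt (fun d : Plane => inner ℝ d b) (innerSL ℝ b) d := by
    have := (innerSL ℝ b).hasFDerivAt (x := d)
    refine this.congr_of_eventuallyEq (.of_forall fun d => ?_)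
    rw [innerSL_apply_apply, real_inner_comm]
  have h4 := h2.mul h3
  convert! h4 using 1
  ext v
  simp [radialHess]
  ring

theorem continuousOn_deriv_norm_sq (hF : ContDiffOn ℝ 2 F (Ioi 0)) :
    ContinuousOn (fun d : Plane => deriv F (‖d‖ ^ 2)) {0}ᶜ :=
  (contDiffOn_deriv_of_Ioi hF).continuousOn.comp (by fun_prop) fun _ hd => norm_sq_mem_Ioi hd

theorem continuousOn_radialGrad (hF : ContDiffOn ℝ 2 F (Ioi 0)) :
    ContinuousOn (radialGrad F) {0}ᶜ :=
  ((continuousOn_deriv_norm_sq hF).const_smul (2 : ℝ)).smul continuous_innerSL.continuousOn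

theorem continuousOn_deriv_deriv_norm_sq (hF : ContDiffOn ℝ 2 F (Ioi 0)) :
    ContinuousOn (fun d : Plane => deriv (deriv F) (‖d‖ ^ 2)) {0}ᶜ :=
  ((contDiffOn_deriv_of_Ioi hF).continuousOn_deriv_of_isOpen isOpen_Ioi le_rfl).comp
    (by fun_prop) fun _ hd => norm_sq_mem_Ioi hd

theorem continuousOn_radialHess (hF : ContDiffOn ℝ 2 F (Ioi 0)) :
    ContinuousOn (fun p : Plane × Plane => radialHess F p.1 p.2) ({0}ᶜ ×ˢ univ) := by
  have hfst : MapsTo (Prod.fst : Plane × Plane → Plane) ({0}ᶜ ×ˢ univ) {0}ᶜ := fun p hp => hp.1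
  have h1 := (continuousOn_deriv_norm_sq hF).comp continuousOn_fst hfst
  have h2 := (continuousOn_deriv_deriv_norm_sq hF).comp continuousOn_fst hfst
  have h3 : ContinuousOn (fun p : Plane × Plane => inner ℝ p.1 p.2) ({0}ᶜ ×ˢ univ) := by fun_prop
  have h4 : ContinuousOn (fun p : Plane × Plane => innerSL ℝ p.2) ({0}ᶜ ×ˢ univ) :=
    (continuous_innerSL.comp continuous_snd).continuousOn
  have h5 : ContinuousOn (fun p : Plane × Plane => innerSL ℝ p.1) ({0}ᶜ ×ˢ univ) :=
    (continuous_innerSL.comp continuous_fst).continuousOn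
  exact ((h1.const_smul (2 : ℝ)).smul h4).add (((h2.const_smul (4 : ℝ)).mul h3).smul h5)

/-- In the plane `JᵀHJ = tr(H) - H` for a symmetric matrix `H` and the rotation `J` by a right
angle; here `H` is a Hessian and its trace the Laplacian. -/
theorem radialHess_rotR_rotR (d a b : Plane) :
    radialHess F d (rotR a) (rotR b) =
      4 * (deriv F (‖d‖ ^ 2) + ‖d‖ ^ 2 * deriv (deriv F) (‖d‖ ^ 2)) * inner ℝ a b
        - radialHess F d b a := by
  simp only [radialHess, _root_.add_apply, _root_.smul_apply, innerSL_apply_apply, smul_eq_mul,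
    inner_rotR_rotR]
  rw [real_inner_comm a b]
  linear_combination 4 * deriv (deriv F) (‖d‖ ^ 2) * inner_rotR_mul_add d a b

section Curve

variable {γ : ℝ → Plane} {f : ℝ → ℝ} {z : Plane}

theorem hasFDerivAt_doubleLayer_curve (hF : ContDiffOn ℝ 2 F (Ioi 0)) (hγ : ContDiff ℝ 1 γ)
    (hper : Function.Periodic γ (2 * π)) (hf : Continuous f) (hz : z ∉ range γ) :
    HasFDerivAt (fun z => ∫ σ in (0 : ℝ)..(2 * π),
        f σ * -radialGrad F (z - γ σ) (rotR (deriv γ σ)))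
      (∫ σ in (0 : ℝ)..(2 * π), f σ • -radialHess F (z - γ σ) (rotR (deriv γ σ))) z := by
  have hcγ := hγ.continuous
  have hcγ' := hγ.continuous_deriv le_rfl
  have hne : ∀ z ∈ (range γ)ᶜ, ∀ σ, z - γ σ ∈ ({0}ᶜ : Set Plane) := fun z hz σ h =>
    hz ⟨σ, (sub_eq_zero.1 h).symm⟩
  have hfc : ContinuousOn (fun p : Plane × ℝ => f p.2) ((range γ)ᶜ ×ˢ univ) := by fun_prop
  have hsub : ContinuousOn (fun p : Plane × ℝ => p.1 - γ p.2) ((range γ)ᶜ ×ˢ univ) := by fun_prop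
  have hmaps : MapsTo (fun p : Plane × ℝ => p.1 - γ p.2) ((range γ)ᶜ ×ˢ univ) {0}ᶜ :=
    fun p hp => hne _ hp.1 _
  have hrot : ContinuousOn (fun p : Plane × ℝ => rotR (deriv γ p.2)) ((range γ)ᶜ ×ˢ univ) := by
    fun_prop
  have hgrad : ContinuousOn (fun p : Plane × ℝ => radialGrad F (p.1 - γ p.2))
      ((range γ)ᶜ ×ˢ univ) :=
    ContinuousOn.comp (g := radialGrad F) (f := fun p : Plane × ℝ => p.1 - γ p.2)
      (continuousOn_radialGrad hF) hsub hmaps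
  have hmaps' : MapsTo (fun p : Plane × ℝ => (p.1 - γ p.2, rotR (deriv γ p.2)))
      ((range γ)ᶜ ×ˢ univ) ({0}ᶜ ×ˢ univ) := fun p hp => mk_mem_prod (hmaps hp) (mem_univ _)
  have hhess : ContinuousOn (fun p : Plane × ℝ => radialHess F (p.1 - γ p.2) (rotR (deriv γ p.2)))
      ((range γ)ᶜ ×ˢ univ) :=
    ContinuousOn.comp (g := fun p : Plane × Plane => radialHess F p.1 p.2)
      (f := fun p : Plane × ℝ => (p.1 - γ p.2, rotR (deriv γ p.2)))
      (continuousOn_radialHess hF) (hsub.prodMk hrot) hmaps'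
  have hk : ContinuousOn (fun p : Plane × ℝ =>
      f p.2 * -radialGrad F (p.1 - γ p.2) (rotR (deriv γ p.2))) ((range γ)ᶜ ×ˢ univ) :=
    hfc.mul (hgrad.clm_apply hrot).neg
  have hk' : ContinuousOn (fun p : Plane × ℝ =>
      f p.2 • -radialHess F (p.1 - γ p.2) (rotR (deriv γ p.2))) ((range γ)ᶜ ×ˢ univ) :=
    hfc.smul hhess.neg
  have hd : ∀ z ∈ (range γ)ᶜ, ∀ σ, HasFDerivAt
      (fun z => f σ * -radialGrad F (z - γ σ) (rotR (deriv γ σ)))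
      (f σ • -radialHess F (z - γ σ) (rotR (deriv γ σ))) z := fun z hz σ => by
    have h1 : HasFDerivAt (fun z => radialGrad F (z - γ σ) (rotR (deriv γ σ)))
        (radialHess F (z - γ σ) (rotR (deriv γ σ))) z :=
      HasFDerivAt.comp (f := fun z => z - γ σ) z
        (hasFDerivAt_radialGrad hF (hne z hz σ) (rotR (deriv γ σ)))
        ((hasFDerivAt_id z).sub_const (γ σ))
    exact h1.neg.const_mul (f σ)
  exact hasFDerivAt_intervalIntegral_param (isClosed_range_of_periodic hcγ hper).isOpen_compl
    (k := fun z σ => f σ * -radialGrad F (z - γ σ) (rotR (deriv γ σ)))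
    (k' := fun z σ => f σ • -radialHess F (z - γ σ) (rotR (deriv γ σ)))
    hk hk' hd 0 (2 * π) hz

theorem continuous_radialHess_apply (hF : ContDiffOn ℝ 2 F (Ioi 0)) (hγ : ContDiff ℝ 1 γ)
    (hz : z ∉ range γ) {b : ℝ → Plane} (hb : Continuous b) :
    Continuous fun σ => radialHess F (z - γ σ) (b σ) :=
  have hcγ := hγ.continuous
  (continuousOn_radialHess hF).comp_continuous (f := fun σ => (z - γ σ, b σ)) (by fun_prop)
    fun σ => ⟨fun h => hz ⟨σ, (sub_eq_zero.1 h).symm⟩, mem_univ _⟩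

theorem integral_mul_radialHess (hF : ContDiffOn ℝ 2 F (Ioi 0)) (hγ : ContDiff ℝ 1 γ)
    (hper : Function.Periodic γ (2 * π)) (hf : ContDiff ℝ 1 f)
    (hfp : Function.Periodic f (2 * π)) (hz : z ∉ range γ) (b : Plane) :
    ∫ σ in (0 : ℝ)..(2 * π), f σ * radialHess F (z - γ σ) b (deriv γ σ)
      = ∫ σ in (0 : ℝ)..(2 * π), deriv f σ * radialGrad F (z - γ σ) b := by
  have hg : ∀ σ, HasDerivAt (fun σ => radialGrad F (z - γ σ) b)
      (-radialHess F (z - γ σ) b (deriv γ σ)) σ := fun σ => by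
    have h1 := (hasFDerivAt_radialGrad hF (sub_ne_zero.2 fun h => hz ⟨σ, h.symm⟩)
      b).comp_hasDerivAt σ ((hγ.differentiable one_ne_zero σ).hasDerivAt.const_sub z)
    exact h1.congr_deriv (map_neg _ _)
  have hcont : Continuous fun σ => -radialHess F (z - γ σ) b (deriv γ σ) :=
    ((continuous_radialHess_apply hF hγ hz continuous_const).clm_apply
      (hγ.continuous_deriv le_rfl)).neg
  have h := intervalIntegral.integral_mul_deriv_eq_deriv_mul (a := 0) (b := 2 * π)
    (fun σ _ => (hf.differentiable one_ne_zero σ).hasDerivAt) (fun σ _ => hg σ)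
    ((hf.continuous_deriv le_rfl).intervalIntegrable _ _) (hcont.intervalIntegrable _ _)
  have e1 : f (2 * π) = f 0 := by simpa using hfp 0
  have e2 : γ (2 * π) = γ 0 := by simpa using hper 0
  rw [e1, e2, sub_self, zero_sub] at h
  simp only [mul_neg, intervalIntegral.integral_neg, neg_inj] at h
  exact h

/-- The derivative of the double layer off the curve, in a direction `J b`. The rotation identity
turns the normal derivatives of the kernel into tangential ones, of which one is integrated by
parts. -/
theorem doubleLayer_curve_fderiv_rotR (hF : ContDiffOn ℝ 2 F (Ioi 0)) (hγ : ContDiff ℝ 1 γ)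
    (hper : Function.Periodic γ (2 * π)) (hf : ContDiff ℝ 1 f)
    (hfp : Function.Periodic f (2 * π)) (hz : z ∉ range γ) (b : Plane) :
    (∫ σ in (0 : ℝ)..(2 * π), f σ • -radialHess F (z - γ σ) (rotR (deriv γ σ))) (rotR b) =
      (∫ σ in (0 : ℝ)..(2 * π), deriv f σ * radialGrad F (z - γ σ) b)
        - ∫ σ in (0 : ℝ)..(2 * π), f σ * (4 * (deriv F (‖z - γ σ‖ ^ 2)
            + ‖z - γ σ‖ ^ 2 * deriv (deriv F) (‖z - γ σ‖ ^ 2)) * inner ℝ b (deriv γ σ)) := by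
  have hcγ := hγ.continuous
  have hcγ' := hγ.continuous_deriv le_rfl
  have hcf := hf.continuous
  have hint : Continuous fun σ => f σ • -radialHess F (z - γ σ) (rotR (deriv γ σ)) :=
    hcf.smul (continuous_radialHess_apply hF hγ hz (by fun_prop)).neg
  have hne : ∀ σ, z - γ σ ∈ ({0}ᶜ : Set Plane) := fun σ h => hz ⟨σ, (sub_eq_zero.1 h).symm⟩
  have hpt : ∀ σ, (f σ • -radialHess F (z - γ σ) (rotR (deriv γ σ))) (rotR b)
      = f σ * radialHess F (z - γ σ) b (deriv γ σ)
        - f σ * (4 * (deriv F (‖z - γ σ‖ ^ 2)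
            + ‖z - γ σ‖ ^ 2 * deriv (deriv F) (‖z - γ σ‖ ^ 2)) * inner ℝ b (deriv γ σ)) := by
    intro σ
    rw [_root_.smul_apply, _root_.neg_apply, radialHess_rotR_rotR, real_inner_comm b, smul_eq_mul]
    ring
  have h1 : Continuous fun σ => deriv F (‖z - γ σ‖ ^ 2) :=
    (continuousOn_deriv_norm_sq hF).comp_continuous (f := fun σ => z - γ σ) (by fun_prop) hne
  have h2 : Continuous fun σ => deriv (deriv F) (‖z - γ σ‖ ^ 2) :=
    (continuousOn_deriv_deriv_norm_sq hF).comp_continuous (f := fun σ => z - γ σ) (by fun_prop) hne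
  rw [ContinuousLinearMap.intervalIntegral_apply (hint.intervalIntegrable _ _),
    ← integral_mul_radialHess hF hγ hper hf hfp hz b, ← intervalIntegral.integral_sub]
  · simp only [hpt]
  · exact (hcf.mul ((continuous_radialHess_apply hF hγ hz
      continuous_const).clm_apply hcγ')).intervalIntegrable _ _
  · refine Continuous.intervalIntegrable ?_ _ _
    exact hcf.mul (((h1.add ((by fun_prop : Continuous fun σ => ‖z - γ σ‖ ^ 2).mul h2)).const_mul
      4).mul (continuous_const.inner hcγ'))

end Curve

end Radial

/-! ### Potentials on the boundary of the domain -/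

namespace C3Domain

variable (Ω : C3Domain) {κ c : ℝ} {i j : Fin Ω.numCurves} {s : ℝ} {ψ : ℝ → ℝ}

theorem contDiff_one (i : Fin Ω.numCurves) : ContDiff ℝ 1 (Ω.curve i) :=
  (Ω.contDiff i).of_le (by norm_num)

theorem injective_mod_period (i : Fin Ω.numCurves) (s t : ℝ) (h : Ω.curve i s = Ω.curve i t) :
    ∃ k : ℤ, t = s + k * (2 * π) :=
  (Ω.simple i i s t h).2

theorem norm_smul_normal (j : Fin Ω.numCurves) (s : ℝ) :
    ‖deriv (Ω.curve j) s‖ • Ω.normal j s = rotR (deriv (Ω.curve j) s) := by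
  rw [normal, unitNormal, smul_inv_smul₀ (norm_ne_zero_iff.2 (Ω.regular j s)), rotR_apply]

theorem normal_eq_rotR (j : Fin Ω.numCurves) (s : ℝ) :
    Ω.normal j s = rotR (‖deriv (Ω.curve j) s‖⁻¹ • deriv (Ω.curve j) s) := by
  rw [map_smul, ← norm_smul_normal, inv_smul_smul₀ (norm_ne_zero_iff.2 (Ω.regular j s))]

theorem inner_deriv_normal (j : Fin Ω.numCurves) (s : ℝ) :
    inner ℝ (deriv (Ω.curve j) s) (Ω.normal j s) = 0 := by
  rw [normal_eq_rotR, map_smul, inner_smul_right, inner_rotR_self, mul_zero]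

theorem normal_ne_zero (j : Fin Ω.numCurves) (s : ℝ) : Ω.normal j s ≠ 0 := by
  intro h
  have h1 := Ω.norm_smul_normal j s
  have h2 := inner_rotR_rotR (deriv (Ω.curve j) s) (deriv (Ω.curve j) s)
  rw [← h1, h, smul_zero, inner_zero_left] at h2
  exact Ω.regular j s (inner_self_eq_zero.1 h2.symm)

theorem isClosed_range (i : Fin Ω.numCurves) : IsClosed (range (Ω.curve i)) :=
  isClosed_range_of_periodic (Ω.contDiff i).continuous (Ω.periodic i)

theorem eventually_chord (j : Fin Ω.numCurves) (s : ℝ) :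
    ∃ c > 0, ∀ᶠ p : ℝ × ℝ in 𝓝 (s, 0), ∀ u ∈ Icc (-π) π,
      c * |u| ≤ ‖Ω.curve j p.1 + p.2 • Ω.normal j s - Ω.curve j (p.1 + u)‖ :=
  eventually_mul_abs_le_norm_chord (Ω.contDiff_one j) (Ω.regular j s)
    (Ω.injective_mod_period j s) (Ω.inner_deriv_normal j s)

theorem notMem_range_of_ne (h : i ≠ j) (s : ℝ) : Ω.curve j s ∉ range (Ω.curve i) := by
  rintro ⟨t, ht⟩
  exact h (Ω.simple i j t s ht).1

/-- Points on the normal through a boundary point, near but different from it, are off the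
boundary. -/
theorem eventually_notMem_range (j : Fin Ω.numCurves) (s : ℝ) :
    ∀ᶠ h : ℝ in 𝓝[≠] 0, ∀ i, Ω.curve j s + h • Ω.normal j s ∉ range (Ω.curve i) := by
  refine eventually_all.2 fun i => ?_
  rcases eq_or_ne i j with rfl | hij
  · obtain ⟨c, hc, h⟩ := Ω.eventually_chord i s
    have hcont : ContinuousAt (fun h : ℝ => (s, h)) 0 := by fun_prop
    filter_upwards [mem_nhdsWithin_of_mem_nhds (hcont.eventually h), self_mem_nhdsWithin]
      with h hh hne
    exact add_smul_notMem_range (Ω.periodic i) (Ω.normal_ne_zero i s) hc (p := (s, h)) hh hne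
  · have hcont : ContinuousAt (fun h : ℝ => Ω.curve j s + h • Ω.normal j s) 0 := by fun_prop
    refine mem_nhdsWithin_of_mem_nhds (hcont.eventually
      ((Ω.isClosed_range i).isOpen_compl.mem_nhds ?_))
    simpa using Ω.notMem_range_of_ne hij s

theorem ae_curve_ne (i : Fin Ω.numCurves) (z : Plane) : ∀ᵐ σ : ℝ, z ≠ Ω.curve i σ := by
  have hc : {σ : ℝ | z = Ω.curve i σ}.Countable := by
    rcases eq_empty_or_nonempty {σ : ℝ | z = Ω.curve i σ} with h | ⟨t, ht⟩
    · rw [h]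
      exact countable_empty
    · refine (countable_range fun k : ℤ => t + k * (2 * π)).mono fun σ hσ => ?_
      obtain ⟨k, hk⟩ := Ω.injective_mod_period i t σ (Eq.trans (Eq.symm ht) hσ)
      exact ⟨k, hk.symm⟩
  exact hc.ae_notMem volume

theorem intervalIntegrable_log (i : Fin Ω.numCurves) (hψ : Continuous ψ)
    (hψp : Function.Periodic ψ (2 * π)) (z : Plane) :
    IntervalIntegrable (fun σ => ψ σ * log ‖z - Ω.curve i σ‖) volume 0 (2 * π) := by
  have hcont := (Ω.contDiff i).continuous
  by_cases hz : z ∈ range (Ω.curve i)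
  · obtain ⟨t, rfl⟩ := hz
    obtain ⟨c, hc, h⟩ := Ω.eventually_chord i t
    have h' := h.self_of_nhds
    simp only [zero_smul, add_zero] at h'
    exact intervalIntegrable_logLayer hcont (Ω.periodic i) hψ hψp hc h'
  · refine Continuous.intervalIntegrable (hψ.mul (Continuous.log (by fun_prop) fun σ => ?_)) _ _
    exact norm_ne_zero_iff.2 (sub_ne_zero.2 fun h => hz ⟨σ, h.symm⟩)

theorem continuous_regularKernel_sub (κ c : ℝ) (n : ℕ) (i : Fin Ω.numCurves) (z : Plane) :
    Continuous fun σ => regularKernel κ c n (z - Ω.curve i σ) :=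
  (contDiff_regularKernel κ c n).continuous.comp
    (continuous_const.sub (Ω.contDiff i).continuous)

theorem intervalIntegrable_profile (κ c : ℝ) (n : ℕ) (i : Fin Ω.numCurves) (hψ : Continuous ψ)
    (hψp : Function.Periodic ψ (2 * π)) (z : Plane) :
    IntervalIntegrable (fun σ => ψ σ * profile κ c n (‖z - Ω.curve i σ‖ ^ 2)) volume 0
      (2 * π) := by
  simp only [profile_norm_sq, mul_add, mul_neg]
  exact (Ω.intervalIntegrable_log i hψ hψp z).neg.add
    ((hψ.mul (Ω.continuous_regularKernel_sub κ c n i z)).intervalIntegrable _ _)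

/-- The single layer on a boundary curve, with Hölder continuous density, has a continuous
tangential derivative across each boundary curve. -/
theorem hasTangentialTrace_singleLayer (κ c : ℝ) (n : ℕ) (i j : Fin Ω.numCurves) (s : ℝ)
    (hψp : Function.Periodic ψ (2 * π)) {C α : ℝ≥0} (hα : 0 < α) (hψα : HolderWith C α ψ) :
    HasTangentialTrace (Ω.curve j) s (Ω.normal j s) (fun z =>
      ∫ σ in (0 : ℝ)..(2 * π), ψ σ * profile κ c n (‖z - Ω.curve i σ‖ ^ 2)) := by
  have hψ : Continuous ψ := hψα.continuous hα
  have hcont := (Ω.contDiff i).continuous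
  rcases eq_or_ne i j with rfl | hij
  · have hsplit : (fun z =>
        ∫ σ in (0 : ℝ)..(2 * π), ψ σ * profile κ c n (‖z - Ω.curve i σ‖ ^ 2))
        = fun z => -(∫ σ in (0 : ℝ)..(2 * π), ψ σ * log ‖z - Ω.curve i σ‖)
          + ∫ σ in (0 : ℝ)..(2 * π), ψ σ * regularKernel κ c n (z - Ω.curve i σ) := by
      funext z
      have hR : Continuous fun σ => ψ σ * regularKernel κ c n (z - Ω.curve i σ) :=
        hψ.mul (Ω.continuous_regularKernel_sub κ c n i z)
      simp only [profile_norm_sq, mul_add, mul_neg]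
      rw [← intervalIntegral.integral_neg]
      exact intervalIntegral.integral_add (Ω.intervalIntegrable_log i hψ hψp z).neg
        (hR.intervalIntegrable _ _)
    rw [hsplit]
    refine (hasTangentialTrace_logLayer ((Ω.contDiff i).of_le (by norm_num)) (Ω.periodic i)
      (Ω.regular i s) (Ω.injective_mod_period i s) (Ω.normal_ne_zero i s)
      (Ω.inner_deriv_normal i s) hψp hα hψα).neg.add ?_
    obtain ⟨R', hR'c, hR'⟩ := contDiff_one_iff_hasFDerivAt.1 (contDiff_regularKernel κ c n)
    exact HasTangentialTrace.of_hasFDerivAt (Ω.contDiff_one i) isOpen_univ (mem_univ _)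
      (fun z hz => hasFDerivAt_layer hcont hψ (V := univ) isOpen_univ (fun d _ => hR' d)
        hR'c.continuousOn (fun _ _ _ => mem_univ _) _ _ hz)
      (continuousOn_layer_fderiv hcont hψ (V := univ) hR'c.continuousOn
        (fun _ _ _ => mem_univ _) _ _)
  · have hF := contDiffOn_profile κ c n
    have hsub : ∀ z ∈ (range (Ω.curve i))ᶜ, ∀ σ, z - Ω.curve i σ ∈ ({0}ᶜ : Set Plane) :=
      fun z hz σ h => hz ⟨σ, (sub_eq_zero.1 h).symm⟩
    exact HasTangentialTrace.of_hasFDerivAt (Ω.contDiff_one j)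
      (Ω.isClosed_range i).isOpen_compl (Ω.notMem_range_of_ne hij s)
      (fun z hz => hasFDerivAt_layer hcont hψ (Ω.isClosed_range i).isOpen_compl
        (fun d hd => hasFDerivAt_radial hF hd) (continuousOn_radialGrad hF) hsub _ _ hz)
      (continuousOn_layer_fderiv hcont hψ (continuousOn_radialGrad hF) hsub _ _)

variable {f : Plane → ℝ} {α : ℝ≥0}

theorem periodic_comp_curve (f : Plane → ℝ) (i : Fin Ω.numCurves) :
    Function.Periodic (fun σ => f (Ω.curve i σ)) (2 * π) :=
  (Ω.periodic i).comp f

theorem periodic_deriv_comp_curve (f : Plane → ℝ) (i : Fin Ω.numCurves) :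
    Function.Periodic (deriv fun σ => f (Ω.curve i σ)) (2 * π) :=
  periodic_deriv (Ω.periodic_comp_curve f i)

/-! ### The operators in terms of the profile of the kernel -/

/-- The single layer with density `df/ds`. -/
noncomputable def tangentialLayer (κ c : ℝ) (n : ℕ) (f : Plane → ℝ) (z : Plane) : ℝ :=
  ∑ i, ∫ σ in (0 : ℝ)..(2 * π),
    deriv (fun σ => f (Ω.curve i σ)) σ * profile κ c n (‖z - Ω.curve i σ‖ ^ 2)

/-- The single layer with kernel `∑_{k ≤ n} β_{n-k} Φ_k` and density `f ⟨b, τ⟩`, where `τ` is the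
unit tangent. As `⟨b, τ⟩ = ⟨J b, ν⟩` for the rotation `J` by a right angle, it carries the operator
`L_n`. -/
noncomputable def convolvedLayer (κ c : ℝ) (n : ℕ) (f : Plane → ℝ) (b z : Plane) : ℝ :=
  ∑ i, ∑ k ∈ Finset.range (n + 1), ∫ σ in (0 : ℝ)..(2 * π),
    (beta κ c (n - k) * (f (Ω.curve i σ) * inner ℝ b (deriv (Ω.curve i) σ)))
      * profile κ c k (‖z - Ω.curve i σ‖ ^ 2)

theorem hasTangentialTrace_tangentialLayer (κ c : ℝ) (n : ℕ) (hα : 0 < α) (hf : Ω.IsC1Holder α f)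
    (j : Fin Ω.numCurves) (s : ℝ) :
    HasTangentialTrace (Ω.curve j) s (Ω.normal j s) (Ω.tangentialLayer κ c n f) :=
  HasTangentialTrace.sum _ fun i _ =>
    have ⟨_, hC⟩ := (hf i).2
    Ω.hasTangentialTrace_singleLayer κ c n i j s (Ω.periodic_deriv_comp_curve f i) hα hC

theorem contDiff_density (hf : Ω.IsC1Holder α f) (i : Fin Ω.numCurves) (b : Plane) (a : ℝ) :
    ContDiff ℝ 1 fun σ => a * (f (Ω.curve i σ) * inner ℝ b (deriv (Ω.curve i) σ)) := by
  have h1 : ContDiff ℝ 1 (deriv (Ω.curve i)) :=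
    ((contDiff_succ_iff_deriv (n := 2)).1 (Ω.contDiff i)).2.2.of_le (by norm_num)
  exact contDiff_const.mul ((hf i).1.mul (contDiff_const.inner ℝ h1))

theorem periodic_density (f : Plane → ℝ) (i : Fin Ω.numCurves) (b : Plane) (a : ℝ) :
    Function.Periodic (fun σ => a * (f (Ω.curve i σ) * inner ℝ b (deriv (Ω.curve i) σ)))
      (2 * π) := fun σ => by
  simp only [Ω.periodic i σ, periodic_deriv (Ω.periodic i) σ]

theorem hasTangentialTrace_convolvedLayer (κ c : ℝ) (n : ℕ) (hf : Ω.IsC1Holder α f) (b : Plane)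
    (j : Fin Ω.numCurves) (s : ℝ) :
    HasTangentialTrace (Ω.curve j) s (Ω.normal j s) (Ω.convolvedLayer κ c n f b) :=
  HasTangentialTrace.sum _ fun i _ => HasTangentialTrace.sum _ fun k _ =>
    have hp := Ω.periodic_density f i b (beta κ c (n - k))
    have ⟨_, hK⟩ := exists_lipschitzWith_of_periodic (Ω.contDiff_density hf i b _) hp
    Ω.hasTangentialTrace_singleLayer κ c k i j s hp one_pos hK.holderWith

theorem smul_integrandH (n : ℕ) (f : Plane → ℝ) (z : Plane) (i : Fin Ω.numCurves) (σ : ℝ) :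
    ‖deriv (Ω.curve i) σ‖ • Ω.integrandH κ c n f z i σ
      = deriv (fun σ => f (Ω.curve i σ)) σ * Phi κ c n z (Ω.curve i σ) := by
  rw [integrandH, arcDeriv, smul_eq_mul, mul_assoc, ← mul_assoc,
    mul_inv_cancel₀ (norm_ne_zero_iff.2 (Ω.regular i σ)), one_mul]

theorem smul_integrandL (n : ℕ) (f : Plane → ℝ) (z : Plane) (i : Fin Ω.numCurves) (σ : ℝ) :
    ‖deriv (Ω.curve i) σ‖ • Ω.integrandL κ c n f z i σ
      = (f (Ω.curve i σ) * ∑ k ∈ Finset.range (n + 1),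
          beta κ c (n - k) * Phi κ c k z (Ω.curve i σ)) • rotR (deriv (Ω.curve i) σ) := by
  rw [integrandL, smul_comm, norm_smul_normal]

theorem boundaryIntegrable_integrandH (hκ : 0 < κ) (hc : 0 < c) (n : ℕ) (hf : Ω.IsC1Holder α f)
    (z : Plane) : Ω.BoundaryIntegrable (Ω.integrandH κ c n f z) := by
  intro i
  simp only [smul_integrandH]
  refine (Ω.intervalIntegrable_profile κ c n i ((hf i).1.continuous_deriv le_rfl)
    (Ω.periodic_deriv_comp_curve f i) z).congr_ae (ae_restrict_of_ae ?_)
  filter_upwards [Ω.ae_curve_ne i z] with σ hσ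
  rw [Phi_eq_profile hκ hc n hσ]

theorem boundaryIntegral_integrandH (hκ : 0 < κ) (hc : 0 < c) (n : ℕ) (f : Plane → ℝ)
    (z : Plane) :
    Ω.boundaryIntegral (Ω.integrandH κ c n f z) = Ω.tangentialLayer κ c n f z := by
  refine Finset.sum_congr rfl fun i _ => intervalIntegral.integral_congr_ae ?_
  filter_upwards [Ω.ae_curve_ne i z] with σ hσ _
  rw [smul_integrandH, Phi_eq_profile hκ hc n hσ]

theorem intervalIntegrable_sum_profile (κ c : ℝ) (n : ℕ) (hf : Ω.IsC1Holder α f)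
    (i : Fin Ω.numCurves) (z : Plane) :
    IntervalIntegrable (fun σ => f (Ω.curve i σ) * ∑ k ∈ Finset.range (n + 1),
      beta κ c (n - k) * profile κ c k (‖z - Ω.curve i σ‖ ^ 2)) volume 0 (2 * π) := by
  simp only [Finset.mul_sum]
  have h : ∀ k ∈ Finset.range (n + 1), IntervalIntegrable (fun σ => f (Ω.curve i σ) *
      (beta κ c (n - k) * profile κ c k (‖z - Ω.curve i σ‖ ^ 2))) volume 0 (2 * π) := by
    intro k _
    refine ((Ω.intervalIntegrable_profile κ c k i (hf i).1.continuous
      (Ω.periodic_comp_curve f i) z).const_mul (beta κ c (n - k))).congr fun σ _ => ?_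
    ring
  simpa only [Finset.sum_fn] using IntervalIntegrable.sum _ h

theorem intervalIntegrable_sum_profile_smul (κ c : ℝ) (n : ℕ) (hf : Ω.IsC1Holder α f)
    (i : Fin Ω.numCurves) (z : Plane) :
    IntervalIntegrable (fun σ => (f (Ω.curve i σ) * ∑ k ∈ Finset.range (n + 1),
      beta κ c (n - k) * profile κ c k (‖z - Ω.curve i σ‖ ^ 2)) • rotR (deriv (Ω.curve i) σ))
      volume 0 (2 * π) :=
  (Ω.intervalIntegrable_sum_profile κ c n hf i z).smul_continuousOn
    (rotR.continuous.comp ((Ω.contDiff_one i).continuous_deriv le_rfl)).continuousOn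

/-- Both sides agree except where `curve i σ = z`; there `Phi` has a junk value. -/
theorem smul_integrandL_ae (hκ : 0 < κ) (hc : 0 < c) (n : ℕ) (f : Plane → ℝ) (z : Plane)
    (i : Fin Ω.numCurves) : ∀ᵐ σ : ℝ, ‖deriv (Ω.curve i) σ‖ • Ω.integrandL κ c n f z i σ
      = (f (Ω.curve i σ) * ∑ k ∈ Finset.range (n + 1), beta κ c (n - k) *
          profile κ c k (‖z - Ω.curve i σ‖ ^ 2)) • rotR (deriv (Ω.curve i) σ) := by
  filter_upwards [Ω.ae_curve_ne i z] with σ hσ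
  rw [smul_integrandL]
  simp only [Phi_eq_profile hκ hc _ hσ]

theorem boundaryIntegrable_integrandL (hκ : 0 < κ) (hc : 0 < c) (n : ℕ) (hf : Ω.IsC1Holder α f)
    (z : Plane) : Ω.BoundaryIntegrable (Ω.integrandL κ c n f z) := fun i =>
  (Ω.intervalIntegrable_sum_profile_smul κ c n hf i z).congr_ae (ae_restrict_of_ae
    ((Ω.smul_integrandL_ae hκ hc n f z i).mono fun _ h => h.symm))

theorem inner_boundaryIntegral_integrandL (hκ : 0 < κ) (hc : 0 < c) (n : ℕ)
    (hf : Ω.IsC1Holder α f) (b z : Plane) :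
    inner ℝ (rotR b) (Ω.boundaryIntegral (Ω.integrandL κ c n f z))
      = Ω.convolvedLayer κ c n f b z := by
  rw [boundaryIntegral, inner_sum, convolvedLayer]
  refine Finset.sum_congr rfl fun i _ => ?_
  rw [intervalIntegral.integral_congr_ae
      ((Ω.smul_integrandL_ae hκ hc n f z i).mono fun _ h _ => h),
    ← innerSL_apply_apply, ← ContinuousLinearMap.intervalIntegral_comp_comm _
      (Ω.intervalIntegrable_sum_profile_smul κ c n hf i z),
    ← intervalIntegral.integral_finsetSum fun k _ => Ω.intervalIntegrable_profile κ c k i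
      (Ω.contDiff_density hf i b _).continuous (Ω.periodic_density f i b _) z]
  refine intervalIntegral.integral_congr fun σ _ => ?_
  simp only [innerSL_apply_apply, inner_smul_right, inner_rotR_rotR, Finset.mul_sum,
    Finset.sum_mul]
  refine Finset.sum_congr rfl fun k _ => ?_
  ring

/-! ### The normal derivative of the double layer -/

theorem doubleLayer_eq (hκ : 0 < κ) (hc : 0 < c) (n : ℕ) (f : Plane → ℝ) {z : Plane}
    (hz : ∀ i, z ∉ range (Ω.curve i)) :
    Ω.doubleLayer κ c n f z = 1 / π * ∑ i, ∫ σ in (0 : ℝ)..(2 * π),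
      f (Ω.curve i σ) * -radialGrad (profile κ c n) (z - Ω.curve i σ)
        (rotR (deriv (Ω.curve i) σ)) := by
  rw [doubleLayer, boundaryIntegral]
  congr 1
  refine Finset.sum_congr rfl fun i _ => intervalIntegral.integral_congr fun σ _ => ?_
  have hne : z ≠ Ω.curve i σ := fun h => hz i ⟨σ, h.symm⟩
  have h1 : HasFDerivAt (fun y => profile κ c n (‖z - y‖ ^ 2))
      (-radialGrad (profile κ c n) (z - Ω.curve i σ)) (Ω.curve i σ) := by
    have := HasFDerivAt.comp (f := fun y : Plane => z - y) (Ω.curve i σ)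
      (hasFDerivAt_radial (contDiffOn_profile κ c n) (sub_ne_zero.2 hne))
      ((hasFDerivAt_id _).const_sub z)
    refine this.congr_fderiv ?_
    ext v
    simp
  have h2 : HasFDerivAt (fun y => Phi κ c n z y)
      (-radialGrad (profile κ c n) (z - Ω.curve i σ)) (Ω.curve i σ) := by
    refine h1.congr_of_eventuallyEq ?_
    filter_upwards [isOpen_ne.mem_nhds hne.symm] with y hy
    exact Phi_eq_profile hκ hc n (Ne.symm hy)
  rw [h2.fderiv, ← norm_smul_normal, map_smul, _root_.neg_apply, smul_eq_mul, smul_eq_mul]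
  ring

/-- The derivative of the double layer at a point off the boundary, in a direction `J b`. -/
theorem exists_hasFDerivAt_doubleLayer (hκ : 0 < κ) (hc : 0 < c) (n : ℕ)
    (hf : Ω.IsC1Holder α f) {z : Plane} (hz : ∀ i, z ∉ range (Ω.curve i)) :
    ∃ u' : Plane →L[ℝ] ℝ, HasFDerivAt (Ω.doubleLayer κ c n f) u' z ∧
      ∀ b, u' (rotR b) = 1 / π * (fderiv ℝ (Ω.tangentialLayer κ c n f) z b
        - Ω.convolvedLayer κ c n f b z) := by
  have hF := contDiffOn_profile κ c n
  have hopen : IsOpen {z : Plane | ∀ i, z ∉ range (Ω.curve i)} := by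
    rw [ofPred_forall]
    exact isOpen_iInter_of_finite fun i => (Ω.isClosed_range i).isOpen_compl
  have hD := (HasFDerivAt.fun_sum (u := Finset.univ) fun i _ =>
    hasFDerivAt_doubleLayer_curve hF (Ω.contDiff_one i) (Ω.periodic i) (hf i).1.continuous
      (hz i)).const_mul (1 / π)
  have hT : HasFDerivAt (Ω.tangentialLayer κ c n f) _ z :=
    HasFDerivAt.fun_sum (u := Finset.univ) fun i _ =>
    hasFDerivAt_layer (Ω.contDiff i).continuous ((hf i).1.continuous_deriv le_rfl)
      (Ω.isClosed_range i).isOpen_compl (fun d hd => hasFDerivAt_radial hF hd)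
      (continuousOn_radialGrad hF)
      (fun z hz σ (h : z - Ω.curve i σ = 0) => hz ⟨σ, (sub_eq_zero.1 h).symm⟩) 0 (2 * π) (hz i)
  refine ⟨_, hD.congr_of_eventuallyEq ?_, fun b => ?_⟩
  · filter_upwards [hopen.mem_nhds hz] with y hy using Ω.doubleLayer_eq hκ hc n f hy
  · rw [hT.fderiv, _root_.smul_apply, smul_eq_mul, _root_.sum_apply,
      _root_.sum_apply, convolvedLayer, ← Finset.sum_sub_distrib]
    congr 1
    refine Finset.sum_congr rfl fun i _ => ?_
    have hne : ∀ σ, z - Ω.curve i σ ∈ ({0}ᶜ : Set Plane) := fun σ h =>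
      hz i ⟨σ, (sub_eq_zero.1 h).symm⟩
    have hgc : Continuous fun σ => deriv (fun σ => f (Ω.curve i σ)) σ •
        radialGrad (profile κ c n) (z - Ω.curve i σ) :=
      ((hf i).1.continuous_deriv le_rfl).smul ((continuousOn_radialGrad hF).comp_continuous
        (f := fun σ => z - Ω.curve i σ) (continuous_const.sub (Ω.contDiff i).continuous) hne)
    rw [doubleLayer_curve_fderiv_rotR hF (Ω.contDiff_one i) (Ω.periodic i) (hf i).1
      (Ω.periodic_comp_curve f i) (hz i) b,
      ContinuousLinearMap.intervalIntegral_apply (hgc.intervalIntegrable _ _),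
      ← intervalIntegral.integral_finsetSum fun k _ => Ω.intervalIntegrable_profile κ c k i
        (Ω.contDiff_density hf i b _).continuous (Ω.periodic_density f i b _) z]
    congr 1
    refine intervalIntegral.integral_congr fun σ _ => ?_
    rw [profile_ode hκ hc n (norm_sq_mem_Ioi (hne σ)), Finset.sum_mul, Finset.mul_sum]
    refine Finset.sum_congr rfl fun k _ => ?_
    ring

/-- The normal derivative of a single double layer: the limit, along the normal, of the formula of
`exists_hasFDerivAt_doubleLayer`. -/
theorem hasNormalDeriv_doubleLayer (hκ : 0 < κ) (hc : 0 < c) (n : ℕ) (hα : 0 < α)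
    (hf : Ω.IsC1Holder α f) (j : Fin Ω.numCurves) (s : ℝ) :
    HasNormalDeriv (Ω.doubleLayer κ c n f) (Ω.curve j s) (Ω.normal j s)
      (Ω.opH κ c n f j s - Ω.opL κ c n f j s) := by
  have hoff := Ω.eventually_notMem_range j s
  refine ⟨?_, ?_⟩
  · filter_upwards [hoff] with h hh
    obtain ⟨u', hu, -⟩ := Ω.exists_hasFDerivAt_doubleLayer hκ hc n hf hh
    exact hu.differentiableAt
  · set b := ‖deriv (Ω.curve j) s‖⁻¹ • deriv (Ω.curve j) s with hb
    have hH := ((Ω.hasTangentialTrace_tangentialLayer κ c n hα hf j s).tendsto_fderiv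
      ((Ω.contDiff_one j).differentiable one_ne_zero)).2.const_mul ‖deriv (Ω.curve j) s‖⁻¹
    have hL := (Ω.hasTangentialTrace_convolvedLayer κ c n hf b j s).tendsto.mono_left
      (nhdsWithin_le_nhds (s := {0}ᶜ))
    have hlim := (hH.sub hL).const_mul (1 / π)
    have hval : Ω.opH κ c n f j s - Ω.opL κ c n f j s
        = 1 / π * (‖deriv (Ω.curve j) s‖⁻¹ *
            deriv (fun t => Ω.tangentialLayer κ c n f (Ω.curve j t)) s
          - Ω.convolvedLayer κ c n f b (Ω.curve j s)) := by
      rw [opH, opL, arcDeriv, Ω.normal_eq_rotR j s, ← hb,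
        Ω.inner_boundaryIntegral_integrandL hκ hc n hf]
      simp only [Ω.boundaryIntegral_integrandH hκ hc]
      ring
    rw [hval]
    refine hlim.congr' ?_
    filter_upwards [hoff] with h hh
    obtain ⟨u', hu, hu'⟩ := Ω.exists_hasFDerivAt_doubleLayer hκ hc n hf hh
    have hν : Ω.normal j s = rotR b := Ω.normal_eq_rotR j s
    have hub := hu' b
    rw [← hν, hb, map_smul, smul_eq_mul] at hub
    rw [hu.fderiv, hub]

end C3Domain

theorem HasNormalDeriv.sum {ι : Type*} (S : Finset ι) {u : ι → Plane → ℝ} {x ν : Plane}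
    {l : ι → ℝ} (h : ∀ i ∈ S, HasNormalDeriv (u i) x ν (l i)) :
    HasNormalDeriv (fun z => ∑ i ∈ S, u i z) x ν (∑ i ∈ S, l i) := by
  have hd : ∀ᶠ h : ℝ in 𝓝[≠] 0, ∀ i ∈ S, DifferentiableAt ℝ (u i) (x + h • ν) :=
    (Filter.eventually_all_finset S).2 fun i hi => (h i hi).1
  refine ⟨hd.mono fun t ht => DifferentiableAt.fun_sum ht, ?_⟩
  refine (tendsto_finsetSum S fun i hi => (h i hi).2).congr' ?_
  filter_upwards [hd] with t ht
  rw [fderiv_fun_sum ht, _root_.sum_apply]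

end LaguerreBIE

theorem mainTheorem3 (κ c : ℝ) (hκ : 0 < κ) (hc : 0 < c) (Ω : LaguerreBIE.C3Domain)
    (α : ℝ≥0) (hα : 0 < α) (hα' : α ≤ 1)
    (q : ℕ → LaguerreBIE.Plane → ℝ) (hq : ∀ m, Ω.IsC1Holder α (q m))
    (n : ℕ) (j : Fin Ω.numCurves) (s : ℝ) :
    (∀ m ∈ Finset.range (n + 1),
      (∀ t : ℝ, Ω.BoundaryIntegrable (Ω.integrandH κ c (n - m) (q m) (Ω.curve j t))) ∧
      DifferentiableAt ℝ
        (fun t => Ω.boundaryIntegral (Ω.integrandH κ c (n - m) (q m) (Ω.curve j t))) s ∧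
      Ω.BoundaryIntegrable (Ω.integrandL κ c (n - m) (q m) (Ω.curve j s))) ∧
    LaguerreBIE.HasNormalDeriv
      (fun z => ∑ m ∈ Finset.range (n + 1), Ω.doubleLayer κ c (n - m) (q m) z)
      (Ω.curve j s) (Ω.normal j s)
      (∑ m ∈ Finset.range (n + 1),
        (Ω.opH κ c (n - m) (q m) j s - Ω.opL κ c (n - m) (q m) j s)) := by
  refine ⟨fun m _ => ⟨fun t => Ω.boundaryIntegrable_integrandH hκ hc _ (hq m) _, ?_,
    Ω.boundaryIntegrable_integrandL hκ hc _ (hq m) _⟩,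
    LaguerreBIE.HasNormalDeriv.sum _ fun m _ =>
      Ω.hasNormalDeriv_doubleLayer hκ hc (n - m) hα (hq m) j s⟩
  simp only [Ω.boundaryIntegral_integrandH hκ hc]
  exact ((Ω.hasTangentialTrace_tangentialLayer κ c (n - m) hα (hq m) j s).tendsto_fderiv
    ((Ω.contDiff_one j).differentiable one_ne_zero)).1
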